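/- Let $K$ be an algebraically closed field (of arbitrary characteristic). For integers $a,b,c\ge 1$ let $SD(3\mathcal K)^{a,b,c}$ be the $K$-algebra $K\Gamma/I$, where $\Gamma$ is the quiver with three vertices $0,1,2$ and six arrows $$\beta:0\to1,\quad \gamma:1\to0,\quad \delta:1\to2,\quad \eta:2\to1,\quad \lambda:2\to0,\quad \kappa:0\to2,$$ paths are written from left to right (so $\beta\delta$ is the path $0\to1\to2$), and $I$ is the two-sided ideal of the path algebra $K\Gamma$ generated by $$\kappa\eta,\quad \eta\gamma,\quad \gamma\kappa,\quad \delta\lambda-(\gamma\beta)^{a-1}\gamma,\quad \beta\delta-(\kappa\lambda)^{b-1}\kappa,\quad \lambda\beta-(\eta\delta)^{c-1}\eta .$$ Two $K$-algebras $A$ and $B$ are called stably equivalent of Morita type if there are an $A$-$B$-bimodule $M$ and a $B$-$A$-bimodule $N$ (with $K$ acting centrally), each finitely generated and projective as a left module and as a right module, together with isomorphisms of bimodules $M\otimes_B N\simeq A\oplus P$ and $N\otimes_A M\simeq B\oplus Q$, where $P$ is a projective $A$-$A$-bimodule and $Q$ is a projective $B$-$B$-bimodule. Let $a\ge b\ge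 c\ge 1$ with $a\ge 2$, and let $a'\ge b'\ge c'\ge 1$ with $a'\ge 2$. Then $SD(3\mathcal K)^{a,b,c}$ is stably equivalent of Morita type to $SD(3\mathcal K)^{a',b',c'}$ if and only if $a=a'$, $b=b'$ and $c=c'$. -/

import Mathlib

universe u

open scoped TensorProduct

noncomputable section

/-! ### Bimodules over algebras -/

/-- An `A`-`B`-bimodule over `K`: a left `A`-module which is a right `B`-module
(that is, a left `Bᵐᵒᵖ`-module), such that the two actions commute and
`K` acts in the same way through `A` and through `B`. -/
structure AlgBimodule (K A B : Type u) [Field K] [Ring A] [Algebra K A] [Ring B] [Algebra K B] where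
  carrier : Type u
  [addCommGroup : AddCommGroup carrier]
  [moduleBase : Module K carrier]
  [moduleLeft : Module A carrier]
  [moduleRight : Module Bᵐᵒᵖ carrier]
  [smulComm : SMulCommClass A Bᵐᵒᵖ carrier]
  [towerLeft : IsScalarTower K A carrier]
  [towerRight : IsScalarTower K Bᵐᵒᵖ carrier]

namespace AlgBimodule

attribute [instance] addCommGroup moduleBase moduleLeft moduleRight smulComm towerLeft towerRight

variable {K A B C : Type u} [Field K] [Ring A] [Algebra K A] [Ring B] [Algebra K B]
  [Ring C] [Algebra K C]

instance : CoeSort (AlgBimodule K A B) (Type u) := ⟨AlgBimodule.carrier⟩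

/-- Isomorphisms of bimodules. -/
structure Iso (M N : AlgBimodule K A B) extends M ≃ₗ[K] N where
  map_left : ∀ (a : A) (m : M), toFun (a • m) = a • toFun m
  map_right : ∀ (b : Bᵐᵒᵖ) (m : M), toFun (b • m) = b • toFun m

/-- The algebra `A` as an `A`-`A`-bimodule. -/
def regular (K A : Type u) [Field K] [Ring A] [Algebra K A] : AlgBimodule K A A where
  carrier := A

/-- The direct sum of two bimodules. -/
def directSum (M N : AlgBimodule K A B) : AlgBimodule K A B where
  carrier := M × N

/-- A bimodule is projective if it is projective as a module over `A ⊗ Bᵐᵒᵖ`,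
which acts by `(a ⊗ b) • m = a • b • m`. -/
def IsProjective (M : AlgBimodule K A B) : Prop :=
  letI : Module (A ⊗[K] Bᵐᵒᵖ) M := TensorProduct.Algebra.module
  Module.Projective (A ⊗[K] Bᵐᵒᵖ) M

/-- Left multiplication by `a`, as a `K`-linear endomorphism. -/
def leftMul (M : AlgBimodule K A B) : A →ₐ[K] Module.End K M := Algebra.lsmul K K M

/-- Right multiplication by `b`, as a `K`-linear endomorphism. -/
def rightMul (M : AlgBimodule K A B) : Bᵐᵒᵖ →ₐ[K] Module.End K M := Algebra.lsmul K K M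

/-- The subspace of `M ⊗[K] N` spanned by all `(m b) ⊗ n - m ⊗ (b n)`. -/
def balancing (M : AlgBimodule K A B) (N : AlgBimodule K B C) : Submodule K (M ⊗[K] N) :=
  Submodule.span K
    {x | ∃ (m : M) (b : B) (n : N), x = (MulOpposite.op b • m) ⊗ₜ[K] n - m ⊗ₜ[K] (b • n)}

lemma balancing_le_left (M : AlgBimodule K A B) (N : AlgBimodule K B C) (a : A) :
    balancing M N ≤ (balancing M N).comap ((M.leftMul a).rTensor N) := by
  refine Submodule.span_le.2 ?_
  rintro _ ⟨m, b, n, rfl⟩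
  refine Submodule.subset_span ⟨a • m, b, n, ?_⟩
  simp [leftMul, smul_comm]

lemma balancing_le_right (M : AlgBimodule K A B) (N : AlgBimodule K B C) (c : Cᵐᵒᵖ) :
    balancing M N ≤ (balancing M N).comap ((N.rightMul c).lTensor M) := by
  refine Submodule.span_le.2 ?_
  rintro _ ⟨m, b, n, rfl⟩
  refine Submodule.subset_span ⟨m, b, c • n, ?_⟩
  simp [rightMul, smul_comm]

/-- The underlying vector space of `M ⊗_B N`. -/
def TensorCarrier (M : AlgBimodule K A B) (N : AlgBimodule K B C) : Type u :=
  (M ⊗[K] N) ⧸ balancing M N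

instance (M : AlgBimodule K A B) (N : AlgBimodule K B C) : AddCommGroup (TensorCarrier M N) :=
  inferInstanceAs (AddCommGroup ((M ⊗[K] N) ⧸ balancing M N))

instance (M : AlgBimodule K A B) (N : AlgBimodule K B C) : Module K (TensorCarrier M N) :=
  inferInstanceAs (Module K ((M ⊗[K] N) ⧸ balancing M N))

/-- The class of `m ⊗ n` in `M ⊗_B N`. -/
def tmk (M : AlgBimodule K A B) (N : AlgBimodule K B C) (m : M) (n : N) : TensorCarrier M N :=
  (balancing M N).mkQ (m ⊗ₜ[K] n)

lemma tensor_end_ext {M : AlgBimodule K A B} {N : AlgBimodule K B C}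
    {f g : Module.End K (TensorCarrier M N)}
    (h : ∀ m n, f (tmk M N m n) = g (tmk M N m n)) : f = g := by
  refine Submodule.linearMap_qext (balancing M N) ?_
  exact TensorProduct.ext' h

/-- The endomorphism `m ⊗ n ↦ (a m) ⊗ n` of `M ⊗_B N`. -/
def tensorLeft (M : AlgBimodule K A B) (N : AlgBimodule K B C) (a : A) :
    Module.End K (TensorCarrier M N) :=
  (balancing M N).mapQ (balancing M N) ((M.leftMul a).rTensor N) (balancing_le_left M N a)

/-- The endomorphism `m ⊗ n ↦ m ⊗ (n c)` of `M ⊗_B N`. -/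
def tensorRight (M : AlgBimodule K A B) (N : AlgBimodule K B C) (c : Cᵐᵒᵖ) :
    Module.End K (TensorCarrier M N) :=
  (balancing M N).mapQ (balancing M N) ((N.rightMul c).lTensor M) (balancing_le_right M N c)

lemma tensorLeft_tmk (M : AlgBimodule K A B) (N : AlgBimodule K B C) (a : A) (m : M) (n : N) :
    tensorLeft M N a (tmk M N m n) = tmk M N (a • m) n := rfl

lemma tensorRight_tmk (M : AlgBimodule K A B) (N : AlgBimodule K B C) (c : Cᵐᵒᵖ) (m : M) (n : N) :
    tensorRight M N c (tmk M N m n) = tmk M N m (c • n) := rfl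

lemma tmk_add_left (M : AlgBimodule K A B) (N : AlgBimodule K B C) (m m' : M) (n : N) :
    tmk M N (m + m') n = tmk M N m n + tmk M N m' n := by
  simp only [tmk, TensorProduct.add_tmul, map_add]; rfl

lemma tmk_add_right (M : AlgBimodule K A B) (N : AlgBimodule K B C) (m : M) (n n' : N) :
    tmk M N m (n + n') = tmk M N m n + tmk M N m n' := by
  simp only [tmk, TensorProduct.tmul_add, map_add]; rfl

lemma tmk_smul_left (M : AlgBimodule K A B) (N : AlgBimodule K B C) (k : K) (m : M) (n : N) :
    tmk M N (k • m) n = k • tmk M N m n := rfl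

lemma tmk_smul_right (M : AlgBimodule K A B) (N : AlgBimodule K B C) (k : K) (m : M) (n : N) :
    tmk M N m (k • n) = k • tmk M N m n := by
  simp only [tmk, TensorProduct.tmul_smul, map_smul]; rfl

lemma tmk_zero_left (M : AlgBimodule K A B) (N : AlgBimodule K B C) (n : N) :
    tmk M N 0 n = 0 := by
  simp only [tmk, TensorProduct.zero_tmul, map_zero]; rfl

lemma tmk_zero_right (M : AlgBimodule K A B) (N : AlgBimodule K B C) (m : M) :
    tmk M N m 0 = 0 := by
  simp only [tmk, TensorProduct.tmul_zero, map_zero]; rfl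

/-- The left action of `A` on `M ⊗_B N`. -/
def tensorLeftHom (M : AlgBimodule K A B) (N : AlgBimodule K B C) :
    A →+* Module.End K (TensorCarrier M N) where
  toFun := tensorLeft M N
  map_one' := tensor_end_ext fun m n => by simp [tensorLeft_tmk]
  map_mul' a a' := tensor_end_ext fun m n => by simp [tensorLeft_tmk, mul_smul]
  map_zero' := tensor_end_ext fun m n => by simp [tensorLeft_tmk, tmk_zero_left]
  map_add' a a' := tensor_end_ext fun m n => by simp [tensorLeft_tmk, add_smul, tmk_add_left]

/-- The right action of `C` on `M ⊗_B N`. -/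
def tensorRightHom (M : AlgBimodule K A B) (N : AlgBimodule K B C) :
    Cᵐᵒᵖ →+* Module.End K (TensorCarrier M N) where
  toFun := tensorRight M N
  map_one' := tensor_end_ext fun m n => by simp [tensorRight_tmk]
  map_mul' c c' := tensor_end_ext fun m n => by simp [tensorRight_tmk, mul_smul]
  map_zero' := tensor_end_ext fun m n => by simp [tensorRight_tmk, tmk_zero_right]
  map_add' c c' := tensor_end_ext fun m n => by simp [tensorRight_tmk, add_smul, tmk_add_right]

instance (M : AlgBimodule K A B) (N : AlgBimodule K B C) : Module A (TensorCarrier M N) :=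
  Module.compHom _ (tensorLeftHom M N)

instance (M : AlgBimodule K A B) (N : AlgBimodule K B C) : Module Cᵐᵒᵖ (TensorCarrier M N) :=
  Module.compHom _ (tensorRightHom M N)

/-- The bimodule `M ⊗_B N`, with `a (m ⊗ n) c = (a m) ⊗ (n c)`. -/
def tensor (M : AlgBimodule K A B) (N : AlgBimodule K B C) : AlgBimodule K A C where
  carrier := TensorCarrier M N
  smulComm := ⟨fun a c x => by
    have h : tensorLeft M N a * tensorRight M N c = tensorRight M N c * tensorLeft M N a :=
      tensor_end_ext fun m n => by simp [tensorLeft_tmk, tensorRight_tmk]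
    exact LinearMap.congr_fun h x⟩
  towerLeft := ⟨fun k a x => by
    have h : tensorLeft M N (k • a) = k • tensorLeft M N a :=
      tensor_end_ext fun m n => by simp [tensorLeft_tmk, tmk_smul_left]
    exact LinearMap.congr_fun h x⟩
  towerRight := ⟨fun k c x => by
    have h : tensorRight M N (k • c) = k • tensorRight M N c :=
      tensor_end_ext fun m n => by simp [tensorRight_tmk, tmk_smul_right]
    exact LinearMap.congr_fun h x⟩

/-- Finitely generated and projective as a left module and as a right module. -/
def IsFGProjectiveOnEachSide (M : AlgBimodule K A B) : Prop :=
  Module.Finite A M ∧ Module.Projective A M ∧ Module.Finite Bᵐᵒᵖ M ∧ Module.Projective Bᵐᵒᵖ M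

end AlgBimodule

/-- `A` and `B` are stably equivalent of Morita type: there are bimodules `M` and `N`, finitely
generated projective on each side, with `M ⊗_B N ≅ A ⊕ P` and `N ⊗_A M ≅ B ⊕ Q` as bimodules,
for projective bimodules `P` and `Q`. -/
def StablyEquivalentOfMoritaType (K A B : Type u) [Field K] [Ring A] [Algebra K A]
    [Ring B] [Algebra K B] : Prop :=
  ∃ (M : AlgBimodule K A B) (N : AlgBimodule K B A),
    M.IsFGProjectiveOnEachSide ∧ N.IsFGProjectiveOnEachSide ∧
    (∃ P : AlgBimodule K A A, P.IsProjective ∧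
      Nonempty ((M.tensor N).Iso ((AlgBimodule.regular K A).directSum P))) ∧
    (∃ Q : AlgBimodule K B B, Q.IsProjective ∧
      Nonempty ((N.tensor M).Iso ((AlgBimodule.regular K B).directSum Q)))

/-! ### The algebras of type `SD(3K)` -/

namespace SD3K

/-- The vertices of the quiver `3K`. -/
inductive Vertex
  | v0 | v1 | v2

/-- The arrows of the quiver `3K`: between any two of the three vertices there is
one arrow in each direction. -/
inductive Arrow
  | β | γ | δ | η | lam | κ

open Vertex Arrow

/-- The source of an arrow. -/
def src : Arrow → Vertex
  | β => v0
  | γ => v1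
  | δ => v1
  | η => v2
  | lam => v2
  | κ => v0

/-- The target of an arrow. -/
def tgt : Arrow → Vertex
  | β => v1
  | γ => v0
  | δ => v2
  | η => v1
  | lam => v0
  | κ => v2

/-- The free algebra on the trivial paths and the arrows. -/
abbrev Free (K : Type u) [Field K] : Type u := FreeAlgebra K (Vertex ⊕ Arrow)

/-- The trivial path at a vertex, in the free algebra. -/
def e (K : Type u) [Field K] (i : Vertex) : Free K := FreeAlgebra.ι K (Sum.inl i)

/-- An arrow, in the free algebra. -/
def ar (K : Type u) [Field K] (x : Arrow) : Free K := FreeAlgebra.ι K (Sum.inr x)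

/-- The defining relations. The first five present the path algebra of the quiver `3K`, a path
being written from left to right in the order in which its arrows are passed;
the other six are the relations of `SD(3K)^{a,b,c}`. -/
inductive Rel (K : Type u) [Field K] (a b c : ℕ) : Free K → Free K → Prop
  | idem (i : Vertex) : Rel K a b c (e K i * e K i) (e K i)
  | orth (i j : Vertex) (h : i ≠ j) : Rel K a b c (e K i * e K j) 0
  | unit : Rel K a b c (e K v0 + e K v1 + e K v2) 1
  | source (x : Arrow) : Rel K a b c (e K (src x) * ar K x) (ar K x)
  | target (x : Arrow) : Rel K a b c (ar K x * e K (tgt x)) (ar K x)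
  | κη : Rel K a b c (ar K κ * ar K η) 0
  | ηγ : Rel K a b c (ar K η * ar K γ) 0
  | γκ : Rel K a b c (ar K γ * ar K κ) 0
  | δlam : Rel K a b c (ar K δ * ar K lam) ((ar K γ * ar K β) ^ (a - 1) * ar K γ)
  | βδ : Rel K a b c (ar K β * ar K δ) ((ar K κ * ar K lam) ^ (b - 1) * ar K κ)
  | lamβ : Rel K a b c (ar K lam * ar K β) ((ar K η * ar K δ) ^ (c - 1) * ar K η)

end SD3K

/-- The algebra `SD(3K)^{a,b,c}` (for `a, b, c ≥ 1`): the quotient of the path algebra over `K` of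
the quiver `3K` by the ideal generated by `κη`, `ηγ`, `γκ`, `δλ - (γβ)^{a-1}γ`,
`βδ - (κλ)^{b-1}κ` and `λβ - (ηδ)^{c-1}η`. -/
def SD3K (K : Type u) [Field K] (a b c : ℕ) : Type u := RingQuot (SD3K.Rel K a b c)

instance (K : Type u) [Field K] (a b c : ℕ) : Ring (SD3K K a b c) :=
  inferInstanceAs (Ring (RingQuot (SD3K.Rel K a b c)))

instance (K : Type u) [Field K] (a b c : ℕ) : Algebra K (SD3K K a b c) :=
  inferInstanceAs (Algebra K (RingQuot (SD3K.Rel K a b c)))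

end

/-! The invariant is the zeroth Hochschild homology `A / [A, A]`, restricted to the span of the
classes of nilpotent elements and taken together with the action of the centre. A bimodule that is
finitely generated projective on the left induces a transfer between these spaces by
Hattori–Stallings traces. Tensor products of bimodules induce composites of transfers, direct sums
induce sums, the regular bimodule induces the identity, and a projective bimodule kills classes of
nilpotent elements. So a stable equivalence of Morita type gives mutually inverse maps on the
nilpotent parts, and conjugation by them carries the action of each central element to that of a
central element (`transfer_centerMul_transfer`, `exists_transfer`).

For `SD(3K)`, write the two-cycle at `i` as `p i * q i`. The nilpotent part is spanned by the
classes of the powers of the two-cycles (`nilSpan_eq`). The power of exponent `n i` is a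
three-cycle, so the three top powers share one class; higher powers vanish. The sum `cycles` of all
two-cycles is central and raises exponents by one, and every central element that vanishes at the
vertices raises exponents by at least one (`centerMul_mem_cyc`). The central element corresponding
to `cycles` vanishes at the vertices, because otherwise it would act on the nonzero top class by a
nonzero scalar, while `cycles` acts nilpotently. Hence the equivalence respects the filtration by
exponents larger than `k` (`finrank_cyc_le`).

A matrix representation over a commutative ring shows that the classes have no further linear
relations (`linearIndependent_cycFamily`). The filtration step has dimension `∑ i, (n i - 1 - k) +
1`, with truncated subtraction, as long as some `n i` exceeds `k`, and dimension zero afterwards.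
These numbers determine the ordered triple of exponents. -/

noncomputable section

/-! ### The zeroth Hochschild homology and traces -/

/-- The subspace spanned by the commutators of an algebra. -/
def commutatorSpan (K A : Type*) [Field K] [Ring A] [Algebra K A] : Submodule K A :=
  Submodule.span K {x | ∃ u v : A, x = u * v - v * u}

/-- The zeroth Hochschild homology `A / [A, A]`. -/
abbrev HochschildZero (K A : Type*) [Field K] [Ring A] [Algebra K A] : Type _ :=
  A ⧸ commutatorSpan K A

namespace HochschildZero

variable {K A : Type*} [Field K] [Ring A] [Algebra K A]

variable (K) in
/-- The class of an element modulo commutators. -/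
def cl : A →ₗ[K] HochschildZero K A := (commutatorSpan K A).mkQ

lemma cl_mul_comm (u v : A) : cl K (u * v) = cl K (v * u) := by
  rw [← sub_eq_zero, ← map_sub]
  exact (Submodule.Quotient.mk_eq_zero _).2 (Submodule.subset_span ⟨u, v, rfl⟩)

lemma cl_surjective : Function.Surjective (cl K : A → HochschildZero K A) :=
  Submodule.mkQ_surjective _

/-- A linear map with `f (u * v) = f (v * u)` descends to `A / [A, A]`. -/
def lift {V : Type*} [AddCommGroup V] [Module K V] (f : A →ₗ[K] V)
    (hf : ∀ u v, f (u * v) = f (v * u)) : HochschildZero K A →ₗ[K] V :=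
  (commutatorSpan K A).liftQ f <| Submodule.span_le.2 <| by
    rintro _ ⟨u, v, rfl⟩
    simp [hf u v]

@[simp]
lemma lift_cl {V : Type*} [AddCommGroup V] [Module K V] (f : A →ₗ[K] V)
    (hf : ∀ u v, f (u * v) = f (v * u)) (x : A) : lift f hf (cl K x) = f x := rfl

/-- Multiplication by a central element on `A / [A, A]`. -/
def centerMul (z : Subalgebra.center K A) : HochschildZero K A →ₗ[K] HochschildZero K A :=
  lift (cl K ∘ₗ LinearMap.mulLeft K (z : A)) fun u v => by
    have hz := Subalgebra.mem_center_iff.1 z.2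
    simp only [LinearMap.comp_apply, LinearMap.mulLeft_apply]
    rw [← mul_assoc, cl_mul_comm, ← mul_assoc, hz v, mul_assoc]

@[simp]
lemma centerMul_cl (z : Subalgebra.center K A) (x : A) :
    centerMul z (cl K x) = cl K ((z : A) * x) := rfl

variable (K A) in
/-- The span of the classes of the nilpotent elements. -/
def nilSpan : Submodule K (HochschildZero K A) :=
  Submodule.span K (cl K '' {x | IsNilpotent x})

lemma cl_mem_nilSpan {x : A} (hx : IsNilpotent x) : cl K x ∈ nilSpan K A :=
  Submodule.subset_span ⟨x, hx, rfl⟩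

/-- The map to `K` induced by a character. -/
def char (χ : A →ₐ[K] K) : HochschildZero K A →ₗ[K] K :=
  lift χ.toLinearMap fun u v => by simp [mul_comm]

@[simp]
lemma char_cl (χ : A →ₐ[K] K) (x : A) : char χ (cl K x) = χ x := rfl

lemma char_eq_zero_of_mem_nilSpan (χ : A →ₐ[K] K) {h : HochschildZero K A}
    (hh : h ∈ nilSpan K A) : char χ h = 0 := by
  have : nilSpan K A ≤ LinearMap.ker (char χ) := by
    refine Submodule.span_le.2 ?_
    rintro _ ⟨x, hx, rfl⟩
    simpa using (IsNilpotent.map hx χ).eq_zero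
  exact this hh

end HochschildZero

open HochschildZero

/-- A finite dual basis of a (finitely generated projective) module. -/
structure FiniteDualBasis (A X : Type*) [Ring A] [AddCommGroup X] [Module A X] where
  ι : Type
  [fintype : Fintype ι]
  vec : ι → X
  coord : ι → X →ₗ[A] A
  sum_coord : ∀ x, ∑ i, coord i x • vec i = x

namespace FiniteDualBasis

attribute [instance] fintype

section

variable {A X Y : Type*} [Ring A] [AddCommGroup X] [Module A X] [AddCommGroup Y] [Module A Y]

lemma nonempty_of_projective [Module.Finite A X] [Module.Projective A X] :
    Nonempty (FiniteDualBasis A X) := by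
  classical
  obtain ⟨n, f, hf⟩ := Module.Finite.exists_fin' A X
  obtain ⟨g, hg⟩ := Module.projective_lifting_property f LinearMap.id hf
  refine ⟨⟨Fin n, fun i => f (Pi.single i 1), fun i => LinearMap.proj i ∘ₗ g, fun x => ?_⟩⟩
  have h : ∑ i, g x i • (Pi.single i 1 : Fin n → A) = g x := by
    ext j
    simp [Pi.single_apply]
  have := congrArg f h
  rw [map_sum] at this
  simpa [← LinearMap.comp_apply, hg] using this

variable (A) in
/-- The dual basis `1` of the regular module. -/
def self : FiniteDualBasis A A where
  ι := Unit
  vec := fun _ => 1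
  coord := fun _ => LinearMap.id
  sum_coord := by simp

variable (K : Type*) [Field K] [Algebra K A]

/-- The Hattori–Stallings trace of an endomorphism. -/
def trace (D : FiniteDualBasis A X) (f : X →ₗ[A] X) : HochschildZero K A :=
  ∑ i, cl K (D.coord i (f (D.vec i)))

/-- Expanding each side in the other dual basis gives the same double sum up to swapping factors
inside `cl`. Since `D` and `E` are arbitrary, this also lets a trace be moved to any module through
which the endomorphism factors. -/
lemma trace_comp_comm (D : FiniteDualBasis A X) (E : FiniteDualBasis A Y)
    (f : X →ₗ[A] Y) (g : Y →ₗ[A] X) : D.trace K (g ∘ₗ f) = E.trace K (f ∘ₗ g) := by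
  have h1 : D.trace K (g ∘ₗ f) =
      ∑ i, ∑ j, cl K (E.coord j (f (D.vec i)) * D.coord i (g (E.vec j))) := by
    refine Finset.sum_congr rfl fun i _ => ?_
    conv_lhs => rw [LinearMap.comp_apply, ← E.sum_coord (f (D.vec i))]
    simp
  have h2 : E.trace K (f ∘ₗ g) =
      ∑ j, ∑ i, cl K (D.coord i (g (E.vec j)) * E.coord j (f (D.vec i))) := by
    refine Finset.sum_congr rfl fun j _ => ?_
    conv_lhs => rw [LinearMap.comp_apply, ← D.sum_coord (g (E.vec j))]
    simp
  rw [h1, h2, Finset.sum_comm]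
  simp_rw [cl_mul_comm (K := K)]

lemma trace_add (D : FiniteDualBasis A X) (f g : X →ₗ[A] X) :
    D.trace K (f + g) = D.trace K f + D.trace K g := by
  simp [trace, Finset.sum_add_distrib]

end

end FiniteDualBasis

/-! ### Transfers along bimodules and their composition. -/

namespace AlgBimodule

variable {K A B C : Type u} [Field K] [Ring A] [Algebra K A] [Ring B] [Algebra K B]
  [Ring C] [Algebra K C]

/-- Multiplication by `b` on the right, as a morphism of left modules. -/
def rmul (M : AlgBimodule K A B) (b : B) : M →ₗ[A] M where
  toFun m := MulOpposite.op b • m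
  map_add' := smul_add _
  map_smul' a m := (smul_comm a _ m).symm

@[simp]
lemma rmul_apply (M : AlgBimodule K A B) (b : B) (m : M) :
    M.rmul b m = MulOpposite.op b • m := rfl

/-- Multiplication by a central element on the left. -/
def lmul (M : AlgBimodule K A B) (z : Subalgebra.center K A) : M →ₗ[A] M where
  toFun m := (z : A) • m
  map_add' := smul_add _
  map_smul' a m := by
    simp only [smul_smul, RingHom.id_apply, Subalgebra.mem_center_iff.1 z.2 a]

@[simp]
lemma lmul_apply (M : AlgBimodule K A B) (z : Subalgebra.center K A) (m : M) :
    M.lmul z m = (z : A) • m := rfl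

lemma rmul_mul (M : AlgBimodule K A B) (b b' : B) :
    M.rmul (b * b') = M.rmul b' ∘ₗ M.rmul b := by
  ext m
  simp [mul_smul]

/-- The transfer `B / [B, B] → A / [A, A]` along an `A`-`B`-bimodule. -/
def transfer (M : AlgBimodule K A B) (D : FiniteDualBasis A M) :
    HochschildZero K B →ₗ[K] HochschildZero K A :=
  HochschildZero.lift
    { toFun := fun b => D.trace K (M.rmul b)
      map_add' := fun b b' => by
        rw [← FiniteDualBasis.trace_add]
        congr 1
        ext m
        simp [add_smul]
      map_smul' := fun k b => by
        simp only [FiniteDualBasis.trace, rmul_apply, RingHom.id_apply, Finset.smul_sum,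
          ← map_smul, MulOpposite.op_smul, smul_assoc]
        refine Finset.sum_congr rfl fun i _ => ?_
        rw [(D.coord i).map_smul_of_tower] }
    fun u v => by
      simp only [LinearMap.coe_mk, AddHom.coe_mk, rmul_mul]
      exact FiniteDualBasis.trace_comp_comm K D D _ _

lemma transfer_cl (M : AlgBimodule K A B) (D : FiniteDualBasis A M) (b : B) :
    M.transfer D (cl K b) = D.trace K (M.rmul b) := rfl

/-- The coordinates are left linear, so a central factor can be moved inside the trace. -/
lemma centerMul_transfer_cl (M : AlgBimodule K A B) (D : FiniteDualBasis A M)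
    (z : Subalgebra.center K A) (b : B) :
    centerMul z (M.transfer D (cl K b)) = D.trace K (M.lmul z ∘ₗ M.rmul b) := by
  simp [transfer_cl, FiniteDualBasis.trace]

/-- The transfer of a nilpotent element is killed by every character. -/
lemma char_transfer_cl_of_isNilpotent (M : AlgBimodule K A B) (D : FiniteDualBasis A M)
    (χ : A →ₐ[K] K) {b : B} (hb : IsNilpotent b) :
    char χ (M.transfer D (cl K b)) = 0 := by
  classical
  let X : B → Matrix D.ι D.ι K := fun b => Matrix.of fun k j => χ (D.coord j (M.rmul b (D.vec k)))
  have hX : ∀ b b', X b * X b' = X (b * b') := by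
    intro b b'
    ext k l
    simp only [X, Matrix.mul_apply, Matrix.of_apply, ← map_mul, ← map_sum]
    congr 1
    conv_rhs => rw [rmul_mul, LinearMap.comp_apply, ← D.sum_coord (M.rmul b (D.vec k))]
    simp only [map_sum, map_smul, smul_eq_mul]
  -- The exponent starts at one because `X 1` is only an idempotent matrix: the module is a direct
  -- summand of a free module, not free.
  have hpow : ∀ n : ℕ, X b ^ (n + 1) = X (b ^ (n + 1)) := by
    intro n
    induction n with
    | zero => simp
    | succ n ih => rw [pow_succ, ih, hX, ← pow_succ]
  have hnil : IsNilpotent (X b) := by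
    obtain ⟨n, hn⟩ := hb
    refine ⟨n + 1, ?_⟩
    rw [hpow, pow_succ, hn]
    ext k j
    simp [X]
  have := (Matrix.isNilpotent_trace_of_isNilpotent hnil).eq_zero
  simpa [transfer_cl, FiniteDualBasis.trace, X, Matrix.trace] using this

section Tensor

variable (M : AlgBimodule K A B) (N : AlgBimodule K B C)

/-- The class of `m ⊗ n`, as an element of the bimodule `M ⊗_B N`. -/
def tens (m : M) (n : N) : M.tensor N := tmk M N m n

variable {M N}

lemma tensor_induction {motive : M.tensor N → Prop} (zero : motive 0)
    (tens : ∀ m n, motive (tens M N m n))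
    (add : ∀ x y, motive x → motive y → motive (x + y)) (x : M.tensor N) : motive x := by
  obtain ⟨t, rfl⟩ := (balancing M N).mkQ_surjective x
  induction t using TensorProduct.induction_on with
  | zero => exact zero
  | tmul m n => exact tens m n
  | add x y hx hy => exact add _ _ hx hy

lemma smul_tens (a : A) (m : M) (n : N) : a • tens M N m n = tens M N (a • m) n := rfl

lemma op_smul_tens (c : Cᵐᵒᵖ) (m : M) (n : N) : c • tens M N m n = tens M N m (c • n) := rfl

lemma tens_add_left (m m' : M) (n : N) : tens M N (m + m') n = tens M N m n + tens M N m' n :=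
  tmk_add_left M N m m' n

lemma tens_add_right (m : M) (n n' : N) : tens M N m (n + n') = tens M N m n + tens M N m n' :=
  tmk_add_right M N m n n'

lemma base_smul_tens_left (k : K) (m : M) (n : N) :
    tens M N (k • m) n = k • tens M N m n := rfl

lemma base_smul_tens_right (k : K) (m : M) (n : N) :
    tens M N m (k • n) = k • tens M N m n := tmk_smul_right M N k m n

lemma tens_balanced (m : M) (b : B) (n : N) :
    tens M N (MulOpposite.op b • m) n = tens M N m (b • n) := by
  refine sub_eq_zero.1 ((Submodule.Quotient.mk_eq_zero (balancing M N)).2 ?_)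
  exact Submodule.subset_span ⟨m, b, n, rfl⟩

lemma tens_sum_left {ι : Type*} (s : Finset ι) (f : ι → M) (n : N) :
    tens M N (∑ i ∈ s, f i) n = ∑ i ∈ s, tens M N (f i) n :=
  map_sum (AddMonoidHom.mk' (fun m => tens M N m n) fun m m' => tens_add_left m m' n) f s

lemma tens_sum_right {ι : Type*} (s : Finset ι) (m : M) (f : ι → N) :
    tens M N m (∑ i ∈ s, f i) = ∑ i ∈ s, tens M N m (f i) :=
  map_sum (AddMonoidHom.mk' (fun n => tens M N m n) fun n n' => tens_add_right m n n') f s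

/-- The morphism `m ⊗ n ↦ φ m n` of left modules on `M ⊗_B N` given by a balanced map. -/
def tensorLift {V : Type*} [AddCommGroup V] [Module K V] [Module A V] (φ : M →ₗ[K] N →ₗ[K] V)
    (hbal : ∀ m (b : B) n, φ (MulOpposite.op b • m) n = φ m (b • n))
    (hlin : ∀ (a : A) m n, φ (a • m) n = a • φ m n) : M.tensor N →ₗ[A] V :=
  let g : (M ⊗[K] N) ⧸ balancing M N →ₗ[K] V :=
    (balancing M N).liftQ (TensorProduct.lift φ) <| Submodule.span_le.2 <| by
      rintro _ ⟨m, b, n, rfl⟩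
      simp [hbal]
  { toFun := g
    map_add' := g.map_add
    map_smul' := fun a x => by
      induction x using tensor_induction with
      | zero =>
        rw [smul_zero]
        exact g.map_zero.trans ((congrArg (a • ·) g.map_zero).trans (smul_zero a)).symm
      | tens m n => exact hlin a m n
      | add x y hx hy =>
        rw [smul_add]
        refine (g.map_add _ _).trans ?_
        rw [hx, hy]
        refine Eq.trans ?_ (congrArg (a • ·) (g.map_add x y).symm)
        exact (smul_add a _ _).symm }

@[simp]
lemma tensorLift_tens {V : Type*} [AddCommGroup V] [Module K V] [Module A V]
    (φ : M →ₗ[K] N →ₗ[K] V) (hbal) (hlin) (m : M) (n : N) :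
    tensorLift (A := A) φ hbal hlin (tens M N m n) = φ m n := rfl

/-- The endomorphism `m ⊗ n ↦ m ⊗ g n` of `M ⊗_B N`. -/
def tensorMapRight (g : N →ₗ[B] N) : M.tensor N →ₗ[A] M.tensor N :=
  tensorLift
    (LinearMap.mk₂ K (fun m n => tens M N m (g n)) (fun m m' n => tens_add_left _ _ _)
      (fun k m n => base_smul_tens_left k m (g n)) (fun m n n' => by rw [map_add, tens_add_right])
      (fun k m n => by rw [g.map_smul_of_tower, base_smul_tens_right]))
    (fun m b n => by simp [tens_balanced]) (fun a m n => by simp [smul_tens])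

@[simp]
lemma tensorMapRight_tens (g : N →ₗ[B] N) (m : M) (n : N) :
    tensorMapRight g (tens M N m n) = tens M N m (g n) := rfl

/-- The dual basis of `M ⊗_B N` obtained from dual bases of `M` and `N`. -/
def tensorDualBasis (D : FiniteDualBasis A M) (E : FiniteDualBasis B N) :
    FiniteDualBasis A (M.tensor N) where
  ι := E.ι × D.ι
  vec ij := tens M N (D.vec ij.2) (E.vec ij.1)
  coord ij := tensorLift
    (LinearMap.mk₂ K (fun m n => D.coord ij.2 (MulOpposite.op (E.coord ij.1 n) • m))
      (fun m m' n => by simp)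
      (fun k m n => by rw [smul_comm, (D.coord ij.2).map_smul_of_tower])
      (fun m n n' => by simp [add_smul])
      (fun k m n => by
        rw [(E.coord ij.1).map_smul_of_tower, MulOpposite.op_smul, smul_assoc,
          (D.coord ij.2).map_smul_of_tower]))
    (fun m b n => by simp [smul_smul])
    (fun a m n => by
      rw [LinearMap.mk₂_apply, LinearMap.mk₂_apply, ← smul_comm a, map_smul])
  sum_coord x := by
    induction x using tensor_induction with
    | zero => simp
    | tens m n =>
      simp only [tensorLift_tens, LinearMap.mk₂_apply, Fintype.sum_prod_type, smul_tens]
      simp only [← tens_sum_left, D.sum_coord, tens_balanced]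
      rw [← tens_sum_right, E.sum_coord]
    | add x y hx hy => simp only [map_add, add_smul, Finset.sum_add_distrib, hx, hy]

/-- Functoriality of transfers: it turns the composite of two transfers into a single trace on the
tensor product. -/
lemma transfer_trace (D : FiniteDualBasis A M) (E : FiniteDualBasis B N) (g : N →ₗ[B] N) :
    M.transfer D (E.trace K g) = (tensorDualBasis D E).trace K (tensorMapRight g) := by
  simp only [FiniteDualBasis.trace, map_sum, transfer_cl]
  exact (Fintype.sum_prod_type fun ij : E.ι × D.ι => cl K (D.coord ij.2
    (MulOpposite.op (E.coord ij.1 (g (E.vec ij.1))) • D.vec ij.2))).symm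

end Tensor

end AlgBimodule

lemma HochschildZero.centerMul_one {K A : Type*} [Field K] [Ring A] [Algebra K A]
    (h : HochschildZero K A) : centerMul 1 h = h := by
  obtain ⟨x, rfl⟩ := cl_surjective h
  rw [centerMul_cl, OneMemClass.coe_one, one_mul]

namespace AlgBimodule

variable {K A B C : Type u} [Field K] [Ring A] [Algebra K A] [Ring B] [Algebra K B]
  [Ring C] [Algebra K C]

/-! ### Projective bimodules have zero transfer on nilpotent classes. -/

section Projective

variable {n : Type} (y : Module.Basis n K B)

/-- The left linear map `u ⊗ v ↦ y_l^*(v) u`. -/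
def tensorCoord (A : Type u) [Ring A] [Algebra K A] (l : n) : A ⊗[K] Bᵐᵒᵖ →ₗ[A] A :=
  (TensorProduct.AlgebraTensorModule.rid K A A).toLinearMap ∘ₗ
    TensorProduct.AlgebraTensorModule.map LinearMap.id
      (y.coord l ∘ₗ (MulOpposite.opLinearEquiv K).symm.toLinearMap)

@[simp]
lemma tensorCoord_tmul (l : n) (u : A) (v : Bᵐᵒᵖ) :
    tensorCoord y A l (u ⊗ₜ v) = y.repr v.unop l • u := by
  simp [tensorCoord]

lemma sum_tensorCoord_smul [Fintype n] (Q : AlgBimodule K A B) (t : A ⊗[K] Bᵐᵒᵖ) (x : Q) :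
    letI : Module (A ⊗[K] Bᵐᵒᵖ) Q := TensorProduct.Algebra.module
    ∑ l, tensorCoord y A l t • MulOpposite.op (y l) • x = t • x := by
  let _ : Module (A ⊗[K] Bᵐᵒᵖ) Q := TensorProduct.Algebra.module
  induction t using TensorProduct.induction_on with
  | zero =>
    simp only [map_zero, zero_smul, Finset.sum_const_zero]
    exact (zero_smul (A ⊗[K] Bᵐᵒᵖ) x).symm
  | tmul u v =>
    have hv : ∑ l, y.repr v.unop l • MulOpposite.op (y l) = v := by
      apply MulOpposite.unop_injective
      rw [Finset.unop_sum]
      simp only [MulOpposite.unop_smul, MulOpposite.unop_op, y.sum_repr]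
    conv_rhs => rw [TensorProduct.Algebra.smul_def, ← hv]
    rw [Finset.sum_smul, Finset.smul_sum]
    refine Finset.sum_congr rfl fun l _ => ?_
    rw [tensorCoord_tmul, smul_assoc, smul_assoc, smul_algebra_smul_comm]
  | add s t hs ht => simp only [map_add, add_smul, Finset.sum_add_distrib, hs, ht]

/-- For a pure tensor `u ⊗ v` the sum is `u` times the `K`-linear trace of `x ↦ v x b` on `B`. Left
and right multiplications commute, so this map is nilpotent along with `b` and has trace zero. -/
lemma sum_tensorCoord_mul [Fintype n] {b : B} (hb : IsNilpotent b) (t : A ⊗[K] Bᵐᵒᵖ) :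
    ∑ l, tensorCoord y A l ((1 ⊗ₜ MulOpposite.op (y l * b)) * t) = 0 := by
  classical
  induction t using TensorProduct.induction_on with
  | zero => simp
  | tmul u v =>
    let L : B →ₗ[K] B := LinearMap.mulRight K b ∘ₗ LinearMap.mulLeft K v.unop
    have hL : IsNilpotent L := by
      obtain ⟨k, hk⟩ := hb
      refine ⟨k, ?_⟩
      have hc : Commute (LinearMap.mulRight K b) (LinearMap.mulLeft K v.unop) :=
        (LinearMap.commute_mulLeft_right v.unop b).symm
      change (LinearMap.mulRight K b * LinearMap.mulLeft K v.unop) ^ k = 0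
      rw [hc.mul_pow, LinearMap.pow_mulRight, hk, LinearMap.mulRight_zero_eq_zero, zero_mul]
    have htr := (LinearMap.isNilpotent_trace_of_isNilpotent hL).eq_zero
    rw [LinearMap.trace_eq_matrix_trace K y] at htr
    have : ∑ l, tensorCoord y A l ((1 ⊗ₜ MulOpposite.op (y l * b)) * (u ⊗ₜ v)) =
        (∑ l, y.repr (L (y l)) l) • u := by
      rw [Finset.sum_smul]
      refine Finset.sum_congr rfl fun l _ => ?_
      simp [L, mul_assoc]
    rw [this]
    convert zero_smul K u
    simpa [Matrix.trace, LinearMap.toMatrix_apply] using htr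
  | add s t hs ht => simp only [mul_add, map_add, Finset.sum_add_distrib, hs, ht, add_zero]

lemma tmul_one_mul (a : A) (t : A ⊗[K] Bᵐᵒᵖ) : (a ⊗ₜ 1) * t = a • t := by
  induction t using TensorProduct.induction_on with
  | zero => simp
  | tmul u v => simp [TensorProduct.smul_tmul']
  | add s t hs ht => rw [mul_add, smul_add, hs, ht]

/-- A projective bimodule has a left dual basis for which all endomorphisms that are the product of
a bimodule endomorphism and the right multiplication by a nilpotent element have trace zero. -/
lemma IsProjective.exists_dualBasis_trace_eq_zero [Module.Finite K B] {Q : AlgBimodule K A B}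
    [Module.Finite K Q] (hQ : Q.IsProjective) :
    ∃ D : FiniteDualBasis A Q, ∀ f : Q →ₗ[A] Q,
      (∀ (b : B) (x : Q), f (MulOpposite.op b • x) = MulOpposite.op b • f x) →
      ∀ b : B, IsNilpotent b → D.trace K (f ∘ₗ Q.rmul b) = 0 := by
  let _ : Module (A ⊗[K] Bᵐᵒᵖ) Q := TensorProduct.Algebra.module
  have : Module.Projective (A ⊗[K] Bᵐᵒᵖ) Q := hQ
  have : IsScalarTower K (A ⊗[K] Bᵐᵒᵖ) Q := ⟨fun k t x =>
    LinearMap.congr_fun (LinearMap.map_smul TensorProduct.Algebra.moduleAux k t) x⟩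
  have : Module.Finite (A ⊗[K] Bᵐᵒᵖ) Q := Module.Finite.of_restrictScalars_finite K _ _
  obtain ⟨E⟩ := FiniteDualBasis.nonempty_of_projective (A := A ⊗[K] Bᵐᵒᵖ) (X := Q)
  let y := Module.finBasis K B
  have hl : ∀ (a : A) (x : Q), a • x = (a ⊗ₜ[K] (1 : Bᵐᵒᵖ)) • x := fun a x => by
    rw [TensorProduct.Algebra.smul_def, one_smul]
  have hr : ∀ (b : Bᵐᵒᵖ) (x : Q), b • x = ((1 : A) ⊗ₜ[K] b) • x := fun b x => by
    rw [TensorProduct.Algebra.smul_def, one_smul]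
  -- A dual basis over `A ⊗ Bᵐᵒᵖ` is refined to one over `A` by means of a `K`-basis `y` of `B`. The
  -- trace over `A` then contains the sums of `sum_tensorCoord_mul`.
  let D : FiniteDualBasis A Q :=
    { ι := E.ι × Fin (Module.finrank K B)
      vec := fun kl => MulOpposite.op (y kl.2) • E.vec kl.1
      coord := fun kl =>
        { toFun := fun x => tensorCoord y A kl.2 (E.coord kl.1 x)
          map_add' := fun x x' => by simp
          map_smul' := fun a x => by
            rw [hl, map_smul, smul_eq_mul, tmul_one_mul, map_smul, RingHom.id_apply] }
      sum_coord := fun x => by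
        rw [Fintype.sum_prod_type]
        conv_rhs => rw [← E.sum_coord x]
        exact Finset.sum_congr rfl fun k _ => sum_tensorCoord_smul y Q (E.coord k x) (E.vec k) }
  refine ⟨D, fun f hf b hb => ?_⟩
  have key : ∀ k, ∑ l, tensorCoord y A l
      (E.coord k (f (Q.rmul b (MulOpposite.op (y l) • E.vec k)))) = 0 := by
    intro k
    rw [← sum_tensorCoord_mul y hb (E.coord k (f (E.vec k)))]
    refine Finset.sum_congr rfl fun l _ => ?_
    rw [rmul_apply, smul_smul, ← MulOpposite.op_mul, hf, hr, map_smul, smul_eq_mul]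
  refine (Fintype.sum_prod_type _).trans ?_
  refine Finset.sum_eq_zero fun k _ => ?_
  rw [← map_sum]
  exact (congrArg (cl K) (key k)).trans (map_zero _)

end Projective

/-- A morphism of left modules which is also compatible with the right action. -/
def IsRightLinear {X Y : AlgBimodule K A B} (f : X →ₗ[A] Y) : Prop :=
  ∀ (b : B) (x : X), f (MulOpposite.op b • x) = MulOpposite.op b • f x

lemma Iso.exists_projections {X Y Q : AlgBimodule K A B} (θ : X.Iso (Y.directSum Q)) :
    ∃ (p : X →ₗ[A] Y) (i : Y →ₗ[A] X) (q : X →ₗ[A] Q) (j : Q →ₗ[A] X),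
      (∀ x, i (p x) + j (q x) = x) ∧ (∀ x, p (i x) = x) ∧ (∀ x, q (j x) = x) ∧
      IsRightLinear p ∧ IsRightLinear i ∧ IsRightLinear q ∧ IsRightLinear j := by
  let f : X →ₗ[A] (Y × Q) :=
    { toFun := fun x => θ.toFun x
      map_add' := fun x x' => θ.map_add' x x'
      map_smul' := fun a x => θ.map_left a x }
  let g : (Y × Q) →ₗ[A] X :=
    { toFun := fun x => θ.invFun x
      map_add' := fun x x' => θ.toLinearEquiv.symm.map_add x x'
      map_smul' := fun a x => by
        have h := (θ.map_left a (θ.invFun x)).trans (congrArg (a • ·) (θ.right_inv x))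
        exact (congrArg θ.invFun h.symm).trans (θ.left_inv _) }
  have hf : ∀ (b : B) x, f (MulOpposite.op b • x) = MulOpposite.op b • f x := fun b x =>
    θ.map_right _ x
  have hgf : ∀ x, g (f x) = x := θ.left_inv
  have hfg : ∀ x, f (g x) = x := θ.right_inv
  have hg : ∀ (b : B) x, g (MulOpposite.op b • x) = MulOpposite.op b • g x := fun b x => by
    conv_lhs => rw [← hfg x, ← hf, hgf]
  refine ⟨LinearMap.fst A Y Q ∘ₗ f, g ∘ₗ LinearMap.inl A Y Q, LinearMap.snd A Y Q ∘ₗ f,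
    g ∘ₗ LinearMap.inr A Y Q, fun x => ?_, fun x => ?_, fun x => ?_, fun b x => ?_, fun b x => ?_,
    fun b x => ?_, fun b x => ?_⟩
  · simp only [LinearMap.comp_apply, ← map_add]
    simp [hgf]
  · simp [hfg]
  · simp [hfg]
  · simp [hf]
  · simp [← hg]
  · simp [hf]
  · simp [← hg]

/-- If `N ⊗_A M` is the sum of `B` and a projective bimodule then, on classes of nilpotent
elements, the transfer along `M`, the multiplication by a central element and the transfer along
`N` compose to the multiplication by a central element. -/
lemma transfer_centerMul_transfer [Module.Finite K B]
    {M : AlgBimodule K A B} {N : AlgBimodule K B A} (D : FiniteDualBasis A M)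
    (E : FiniteDualBasis B N) [Module.Finite K (N.tensor M)] {Q : AlgBimodule K B B}
    (hQ : Q.IsProjective) (θ : (N.tensor M).Iso ((regular K B).directSum Q)) :
    (∀ h ∈ nilSpan K B, N.transfer E (M.transfer D h) = h) ∧
    ∀ z : Subalgebra.center K A, ∃ w : Subalgebra.center K B, ∀ h ∈ nilSpan K B,
      N.transfer E (centerMul z (M.transfer D h)) = centerMul w h := by
  obtain ⟨p, i, q, j, hsum, hpi, hqj, hp, hi, hq, hj⟩ :
    ∃ (p : N.tensor M →ₗ[B] B) (i : B →ₗ[B] N.tensor M) (q : N.tensor M →ₗ[B] Q)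
      (j : Q →ₗ[B] N.tensor M), (∀ x, i (p x) + j (q x) = x) ∧ (∀ x, p (i x) = x) ∧
      (∀ x, q (j x) = x) ∧ (∀ (b : B) x, p (MulOpposite.op b • x) = p x * b) ∧
      (∀ b x : B, i (x * b) = MulOpposite.op b • i x) ∧ IsRightLinear q ∧ IsRightLinear j :=
    θ.exists_projections
  have : Module.Finite K Q :=
    Module.Finite.of_surjective (q.restrictScalars K) fun x => ⟨j x, hqj x⟩
  obtain ⟨D', hD'⟩ := hQ.exists_dualBasis_trace_eq_zero
  have hF : ∀ (z : Subalgebra.center K A) (b : B) (x : N.tensor M),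
      tensorMapRight (M.lmul z ∘ₗ M.rmul b) x =
        MulOpposite.op b • tensorMapRight (M.lmul z) x := by
    intro z b x
    induction x using tensor_induction with
    | zero => simp
    | tens n m => simp [op_smul_tens, smul_comm]
    | add x y hx hy => rw [map_add, map_add, smul_add, hx, hy]
  have hF' : ∀ z : Subalgebra.center K A,
      IsRightLinear (tensorMapRight (M := N) (M.lmul z)) := by
    intro z b x
    induction x using tensor_induction with
    | zero => simp
    | tens n m => simp [op_smul_tens, smul_comm]
    | add x y hx hy => rw [smul_add, map_add, map_add, smul_add, hx, hy]
  have key : ∀ (z : Subalgebra.center K A) (b : B), IsNilpotent b →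
      N.transfer E (centerMul z (M.transfer D (cl K b))) =
        cl K (p (tensorMapRight (M.lmul z) (i 1)) * b) := by
    intro z b hb
    rw [centerMul_transfer_cl, transfer_trace]
    set F := tensorMapRight (M := N) (M.lmul z ∘ₗ M.rmul b) with hFdef
    -- The trace of `F` splits along `B ⊕ Q`. The first part moves to `B`, where a trace is
    -- evaluation at `1`; the second moves to `Q`.
    have hdec : F = i ∘ₗ (p ∘ₗ F) + j ∘ₗ (q ∘ₗ F) := by
      ext x
      exact (hsum (F x)).symm
    rw [hdec, FiniteDualBasis.trace_add,
      FiniteDualBasis.trace_comp_comm K _ (FiniteDualBasis.self B) (p ∘ₗ F) i,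
      FiniteDualBasis.trace_comp_comm K _ D' (q ∘ₗ F) j]
    -- On `Q` the map is a bimodule endomorphism composed with right multiplication by the nilpotent
    -- `b`, so `hD'` kills its trace.
    have h2 : (q ∘ₗ F) ∘ₗ j = (q ∘ₗ tensorMapRight (M.lmul z) ∘ₗ j) ∘ₗ Q.rmul b := by
      ext x
      simp only [LinearMap.comp_apply, hF, hFdef, rmul_apply]
      rw [hj, hF']
    rw [h2, hD' _ (fun b x => by
      simp only [LinearMap.comp_apply]
      rw [hj, hF', hq]) b hb, add_zero]
    have h1 : p (F (i 1)) = p (tensorMapRight (M.lmul z) (i 1)) * b := by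
      rw [hFdef, hF]
      exact hp b _
    rw [← h1]
    exact Finset.sum_singleton _ _
  have ext : ∀ f g : HochschildZero K B →ₗ[K] HochschildZero K B,
      (∀ b, IsNilpotent b → f (cl K b) = g (cl K b)) → ∀ h ∈ nilSpan K B, f h = g h := by
    intro f g hfg h hh
    have : nilSpan K B ≤ LinearMap.eqLocus f g := by
      refine Submodule.span_le.2 ?_
      rintro _ ⟨b, hb, rfl⟩
      exact hfg b hb
    exact this hh
  have hone : (tensorMapRight (M.lmul 1) : N.tensor M →ₗ[B] N.tensor M) = LinearMap.id := by
    ext x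
    induction x using tensor_induction with
    | zero => simp
    | tens n m => simp
    | add x y hx hy => rw [map_add, hx, hy, map_add]
  refine ⟨ext (N.transfer E ∘ₗ M.transfer D) LinearMap.id fun b hb => ?_, fun z => ?_⟩
  · have := key 1 b hb
    rw [hone] at this
    rw [LinearMap.id_apply, hpi, one_mul, centerMul_one] at this
    exact this
  -- This is the image of `1` under a bimodule endomorphism of `B`, hence central.
  · refine ⟨⟨p (tensorMapRight (M.lmul z) (i 1)), ?_⟩, ?_⟩
    · refine Subalgebra.mem_center_iff.2 fun b => ?_
      rw [← smul_eq_mul, ← map_smul, ← map_smul, ← map_smul, smul_eq_mul, mul_one, ← hp, ← hF',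
        ← hi, one_mul]
    · exact ext (N.transfer E ∘ₗ centerMul z ∘ₗ M.transfer D) (centerMul _) fun b hb => key z b hb

lemma finite_tensor [Module.Finite K A] [Module.Finite K B] (M : AlgBimodule K A B)
    (N : AlgBimodule K B C) [Module.Finite A M] [Module.Finite B N] :
    Module.Finite K (M.tensor N) := by
  have : Module.Finite K M := Module.Finite.trans A M
  have : Module.Finite K N := Module.Finite.trans B N
  exact inferInstanceAs (Module.Finite K ((M ⊗[K] N) ⧸ balancing M N))

end AlgBimodule

/-! ### Stable equivalences and the nilpotent part of the zeroth Hochschild homology. -/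

namespace StablyEquivalentOfMoritaType

variable {K A B : Type u} [Field K] [Ring A] [Algebra K A] [Ring B] [Algebra K B]

lemma symm (h : StablyEquivalentOfMoritaType K A B) : StablyEquivalentOfMoritaType K B A :=
  let ⟨M, N, hM, hN, hP, hQ⟩ := h
  ⟨N, M, hN, hM, hQ, hP⟩

variable (K A) in
lemma refl : StablyEquivalentOfMoritaType K A A := by
  let R := AlgBimodule.regular K A
  have hfg : R.IsFGProjectiveOnEachSide := by
    let e : Aᵐᵒᵖ ≃ₗ[Aᵐᵒᵖ] A :=
      { toFun := MulOpposite.unop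
        invFun := MulOpposite.op
        map_add' := fun _ _ => rfl
        map_smul' := fun _ _ => rfl
        left_inv := fun _ => rfl
        right_inv := fun _ => rfl }
    exact ⟨inferInstanceAs (Module.Finite A A), inferInstanceAs (Module.Projective A A),
      Module.Finite.equiv e, Module.Projective.of_equiv e⟩
  -- The zero bimodule serves as the projective complement, since `A ⊗_A A` is `A` itself.
  let O : AlgBimodule K A A := { carrier := PUnit }
  let f : R.tensor R →ₗ[A] A := AlgBimodule.tensorLift (M := R) (N := R) (LinearMap.mul K A)
    (fun m b n => mul_assoc (G := A) m b n) (fun a m n => mul_assoc (G := A) a m n)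
  have hft : ∀ x y : A, f (AlgBimodule.tens R R x y) = x * y := fun x y => rfl
  have hsurj : ∀ x : R.tensor R, AlgBimodule.tens R R (f x) (1 : A) = x := by
    intro x
    induction x using AlgBimodule.tensor_induction with
    | zero => rw [map_zero]; exact AlgBimodule.tmk_zero_left R R (1 : A)
    | tens m n =>
      refine (AlgBimodule.tens_balanced (M := R) (N := R) m n (1 : A)).trans ?_
      exact congrArg (AlgBimodule.tens R R m) (mul_one (M := A) n)
    | add x y hx hy => rw [map_add]; exact (AlgBimodule.tens_add_left _ _ _).trans (by rw [hx, hy])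
  have hright : ∀ (b : Aᵐᵒᵖ) (x : R.tensor R), f (b • x) = f x * b.unop := by
    intro b x
    induction x using AlgBimodule.tensor_induction with
    | zero => rw [smul_zero, map_zero, zero_mul]
    | tens m n => exact (mul_assoc (G := A) m n b.unop).symm
    | add x y hx hy => rw [smul_add, map_add, map_add, add_mul, hx, hy]
  let θ : (R.tensor R).Iso (R.directSum O) :=
    { toFun := fun x => (f x, PUnit.unit)
      map_add' := fun x y => Prod.ext (f.map_add x y) rfl
      map_smul' := fun k x => Prod.ext (f.map_smul_of_tower k x) rfl
      invFun := fun x => AlgBimodule.tens R R x.1 (1 : A)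
      left_inv := hsurj
      right_inv := fun x => Prod.ext ((hft _ _).trans (mul_one (M := A) x.1)) rfl
      map_left := fun a x => Prod.ext (f.map_smul a x) rfl
      map_right := fun b x => Prod.ext (hright b x) rfl }
  have hO : O.IsProjective := by
    let _ : Module (A ⊗[K] Aᵐᵒᵖ) O := TensorProduct.Algebra.module
    have : Subsingleton O := inferInstanceAs (Subsingleton PUnit)
    exact Module.Projective.of_free
  exact ⟨R, R, hfg, hfg, ⟨O, hO, ⟨θ⟩⟩, ⟨O, hO, ⟨θ⟩⟩⟩

/-- A stable equivalence of Morita type identifies the spans of the classes of nilpotent elements in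
the zeroth Hochschild homology, in a way that is compatible with the actions of the centres. -/
theorem exists_transfer [Module.Finite K A] [Module.Finite K B]
    (hA : ∀ h : HochschildZero K A, (∀ χ, char χ h = 0) → h ∈ nilSpan K A)
    (hB : ∀ h : HochschildZero K B, (∀ χ, char χ h = 0) → h ∈ nilSpan K B)
    (hAB : StablyEquivalentOfMoritaType K A B) :
    ∃ (s : HochschildZero K A →ₗ[K] HochschildZero K B)
      (t : HochschildZero K B →ₗ[K] HochschildZero K A),
      (∀ h ∈ nilSpan K A, s h ∈ nilSpan K B ∧ t (s h) = h) ∧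
      (∀ h ∈ nilSpan K B, t h ∈ nilSpan K A ∧ s (t h) = h) ∧
      ∀ z : Subalgebra.center K A, ∃ w : Subalgebra.center K B, ∀ h ∈ nilSpan K B,
        s (centerMul z (t h)) = centerMul w h := by
  obtain ⟨M, N, ⟨_, _, _, _⟩, ⟨_, _, _, _⟩, ⟨P, hP, ⟨θ⟩⟩, ⟨Q, hQ, ⟨θ'⟩⟩⟩ := hAB
  obtain ⟨D⟩ := FiniteDualBasis.nonempty_of_projective (A := A) (X := M)
  obtain ⟨E⟩ := FiniteDualBasis.nonempty_of_projective (A := B) (X := N)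
  have := M.finite_tensor N
  have := N.finite_tensor M
  obtain ⟨h1, -⟩ := AlgBimodule.transfer_centerMul_transfer E D hP θ
  obtain ⟨h2, h3⟩ := AlgBimodule.transfer_centerMul_transfer D E hQ θ'
  refine ⟨N.transfer E, M.transfer D, fun h hh => ⟨?_, h1 h hh⟩, fun h hh => ⟨?_, h2 h hh⟩, h3⟩
  -- Transfers of nilpotent classes are only known to be killed by all characters; `hA` and `hB`
  -- bring them back into the nilpotent spans.
  · refine (show nilSpan K A ≤ (nilSpan K B).comap (N.transfer E) from ?_) hh
    refine Submodule.span_le.2 ?_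
    rintro _ ⟨x, hx, rfl⟩
    exact hB _ fun χ => N.char_transfer_cl_of_isNilpotent E χ hx
  · refine (show nilSpan K B ≤ (nilSpan K A).comap (M.transfer D) from ?_) hh
    refine Submodule.span_le.2 ?_
    rintro _ ⟨x, hx, rfl⟩
    exact hA _ fun χ => M.char_transfer_cl_of_isNilpotent D χ hx

end StablyEquivalentOfMoritaType

/-! ### Consequences of the relations: normal forms of paths, nilpotency, the central sum of
two-cycles. -/

namespace SD3K

/-- The relations of `SD(3K)` with exponents `n`, in cyclic notation: `p i` is the arrow
`i → i + 1`, and `q i` the arrow `i + 1 → i`. -/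
structure Relations {R : Type*} [Ring R] (n : Fin 3 → ℕ) (e p q : Fin 3 → R) : Prop where
  idem (i) : e i * e i = e i
  orth (i j) (h : i ≠ j) : e i * e j = 0
  unit : e 0 + e 1 + e 2 = 1
  e_mul_p (i) : e i * p i = p i
  p_mul_e (i) : p i * e (i + 1) = p i
  e_mul_q (i) : e (i + 1) * q i = q i
  q_mul_e (i) : q i * e i = q i
  q_succ_mul_q (i) : q (i + 1) * q i = 0
  p_mul_p (i) : p (i + 1) * p (i + 2) = (q i * p i) ^ (n i - 1) * q i

lemma mul_pow_mul_eq {R : Type*} [Monoid R] (x y : R) (m : ℕ) :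
    (x * y) ^ m * x = x * (y * x) ^ m := by
  induction m with
  | zero => simp
  | succ m ih => rw [pow_succ', mul_assoc, ih, pow_succ']; simp only [mul_assoc]

/-- The paths that span the algebra. -/
inductive IsWord {R : Type*} [Ring R] (e p q : Fin 3 → R) : R → Prop
  | vertex (i) : IsWord e p q (e i)
  | pq (i m) : IsWord e p q ((p i * q i) ^ (m + 1))
  | qp (i m) : IsWord e p q ((q i * p i) ^ (m + 1))
  | pqp (i m) : IsWord e p q ((p i * q i) ^ m * p i)
  | qpq (i m) : IsWord e p q ((q i * p i) ^ m * q i)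

section

variable {R : Type*} [Ring R] {p q : Fin 3 → R} {K : Type*} [Field K] [Algebra K R]

lemma cl_qp_pow (i : Fin 3) (m : ℕ) :
    cl K ((q i * p i) ^ (m + 1)) = cl K ((p i * q i) ^ (m + 1)) := by
  rw [pow_succ, ← mul_assoc, cl_mul_comm, mul_pow_mul_eq, ← mul_assoc, ← pow_succ']

variable (K p q) in
/-- The span of the classes of the `m`-th powers of the two-cycles with `m > k`. -/
def cycleSpan (k : ℕ) : Submodule K (HochschildZero K R) :=
  Submodule.span K {h | ∃ i m, k < m ∧ h = cl K ((p i * q i) ^ m)}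

lemma cl_mem_cycleSpan (i : Fin 3) {k m : ℕ} (h : k < m) :
    cl K ((p i * q i) ^ m) ∈ cycleSpan p q K k :=
  Submodule.subset_span ⟨i, m, h, rfl⟩

variable (K p q) in
/-- The span of the classes of the `m`-th powers of the two-cycle at `i` with `m > k`. -/
def chainSpan (i : Fin 3) (k : ℕ) : Submodule K (HochschildZero K R) :=
  Submodule.span K {h | ∃ m, k < m ∧ h = cl K ((p i * q i) ^ m)}

lemma chainSpan_le_cycleSpan (i : Fin 3) (k : ℕ) : chainSpan p q K i k ≤ cycleSpan p q K k := by
  refine Submodule.span_mono ?_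
  rintro _ ⟨m, hm, rfl⟩
  exact ⟨i, m, hm, rfl⟩

end

namespace Relations

variable {R : Type*} [Ring R] {n : Fin 3 → ℕ} {e p q : Fin 3 → R}

lemma e_mul_p_of_ne (H : Relations n e p q) {i j : Fin 3} (h : i ≠ j) : e i * p j = 0 := by
  rw [← H.e_mul_p j, ← mul_assoc, H.orth i j h, zero_mul]

lemma e_mul_q_of_ne (H : Relations n e p q) {i j : Fin 3} (h : i ≠ j + 1) : e i * q j = 0 := by
  rw [← H.e_mul_q j, ← mul_assoc, H.orth i _ h, zero_mul]

lemma p_mul_e_of_ne (H : Relations n e p q) {i j : Fin 3} (h : j ≠ i + 1) : p i * e j = 0 := by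
  rw [← H.p_mul_e i, mul_assoc, H.orth _ j h.symm, mul_zero]

lemma q_mul_e_of_ne (H : Relations n e p q) {i j : Fin 3} (h : i ≠ j) : q i * e j = 0 := by
  rw [← H.q_mul_e i, mul_assoc, H.orth _ j h, mul_zero]

lemma p_mul_p_of_ne (H : Relations n e p q) {i j : Fin 3} (h : j ≠ i + 1) : p i * p j = 0 := by
  rw [← H.e_mul_p j, ← mul_assoc, H.p_mul_e_of_ne h, zero_mul]

lemma p_mul_q_of_ne (H : Relations n e p q) {i j : Fin 3} (h : i ≠ j) : p i * q j = 0 := by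
  rw [← H.e_mul_q j, ← mul_assoc, H.p_mul_e_of_ne (by simpa using h.symm), zero_mul]

lemma q_mul_p_of_ne (H : Relations n e p q) {i j : Fin 3} (h : i ≠ j) : q i * p j = 0 := by
  rw [← H.e_mul_p j, ← mul_assoc, H.q_mul_e_of_ne h, zero_mul]

lemma q_mul_q (H : Relations n e p q) (i j : Fin 3) : q i * q j = 0 := by
  by_cases h : i = j + 1
  · rw [h, H.q_succ_mul_q]
  · rw [← H.e_mul_q j, ← mul_assoc, H.q_mul_e_of_ne h, zero_mul]

lemma p_mul_p_succ (H : Relations n e p q) (i : Fin 3) :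
    p i * p (i + 1) = (q (i + 2) * p (i + 2)) ^ (n (i + 2) - 1) * q (i + 2) := by
  have h := H.p_mul_p (i + 2)
  have h1 : ∀ i : Fin 3, i + 2 + 1 = i := by decide
  have h2 : ∀ i : Fin 3, i + 2 + 2 = i + 1 := by decide
  rwa [h1, h2] at h

/-- A nonzero `p j * p k` can be rewritten as a word that begins and ends with a `q`, and products
of two `q`'s vanish. The same reason gives `p_mul_p_mul_q`. -/
lemma q_mul_p_mul_p (H : Relations n e p q) (i j k : Fin 3) : q i * (p j * p k) = 0 := by
  by_cases h : k = j + 1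
  · rw [h, H.p_mul_p_succ, mul_pow_mul_eq, ← mul_assoc, H.q_mul_q, zero_mul]
  · rw [H.p_mul_p_of_ne h, mul_zero]

lemma p_mul_p_mul_q (H : Relations n e p q) (i j k : Fin 3) : p i * (p j * q k) = 0 := by
  by_cases h : j = i + 1
  · rw [h, ← mul_assoc, H.p_mul_p_succ, mul_assoc, H.q_mul_q, mul_zero]
  · rw [← mul_assoc, H.p_mul_p_of_ne h, zero_mul]

/-- Multiplying the relation `p_mul_p` by `p i` on the left completes its right side to a full power
of the two-cycle. This is what links the three two-cycles. -/
lemma pq_pow (H : Relations n e p q) (hn : ∀ i, 1 ≤ n i) (i : Fin 3) :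
    (p i * q i) ^ n i = p i * (p (i + 1) * p (i + 2)) := by
  rw [H.p_mul_p]
  conv_lhs => rw [← Nat.sub_add_cancel (hn i), pow_succ, ← mul_assoc, mul_pow_mul_eq, mul_assoc]

lemma pq_pow_eq_zero (H : Relations n e p q) (hn : ∀ i, 1 ≤ n i) (i : Fin 3) {m : ℕ}
    (hm : n i < m) :
    (p i * q i) ^ m = 0 := by
  refine pow_eq_zero_of_le hm ?_
  rw [pow_succ, H.pq_pow hn, mul_assoc, mul_assoc, H.p_mul_p_mul_q, mul_zero, mul_zero]

lemma isNilpotent_pq (H : Relations n e p q) (hn : ∀ i, 1 ≤ n i) (i : Fin 3) :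
    IsNilpotent (p i * q i) :=
  ⟨_, H.pq_pow_eq_zero hn i (Nat.lt_succ_self _)⟩

/-- The bound is not sharp: it comes from `(q p)^(k+1) = q (p q)^k p`, which suffices for
finiteness. -/
lemma qp_pow_eq_zero (H : Relations n e p q) (hn : ∀ i, 1 ≤ n i) (i : Fin 3) {m : ℕ}
    (hm : n i + 1 < m) :
    (q i * p i) ^ m = 0 := by
  obtain ⟨k, rfl⟩ : ∃ k, m = k + 1 := ⟨m - 1, by omega⟩
  rw [pow_succ, ← mul_assoc, mul_pow_mul_eq, H.pq_pow_eq_zero hn i (by omega), mul_zero, zero_mul]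

lemma isWord_mul_e (H : Relations n e p q) {x : R} (hx : IsWord e p q x) (j : Fin 3) :
    x * e j = 0 ∨ IsWord e p q (x * e j) := by
  cases hx with
  | vertex i =>
    by_cases h : i = j
    · subst h; rw [H.idem]; exact .inr (.vertex i)
    · exact .inl (H.orth i j h)
  | pq i m =>
    by_cases h : i = j
    · subst h; right; rw [pow_succ, mul_assoc, mul_assoc, H.q_mul_e, ← pow_succ]; exact .pq i m
    · left; rw [pow_succ, mul_assoc, mul_assoc, H.q_mul_e_of_ne h, mul_zero, mul_zero]
  | qp i m =>
    by_cases h : j = i + 1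
    · subst h; right; rw [pow_succ, mul_assoc, mul_assoc, H.p_mul_e, ← pow_succ]; exact .qp i m
    · left; rw [pow_succ, mul_assoc, mul_assoc, H.p_mul_e_of_ne h, mul_zero, mul_zero]
  | pqp i m =>
    by_cases h : j = i + 1
    · subst h; right; rw [mul_assoc, H.p_mul_e]; exact .pqp i m
    · left; rw [mul_assoc, H.p_mul_e_of_ne h, mul_zero]
  | qpq i m =>
    by_cases h : i = j
    · subst h; right; rw [mul_assoc, H.q_mul_e]; exact .qpq i m
    · left; rw [mul_assoc, H.q_mul_e_of_ne h, mul_zero]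

/-- The only nonzero product that is not already alternating is `p i * p (i + 1)`, which the
relations turn into an alternating word in `q (i + 2)` and `p (i + 2)`. Longer words ending in `q p`
or `q p p` patterns are killed by `q_mul_p_mul_p`. -/
lemma isWord_mul_p (H : Relations n e p q) {x : R} (hx : IsWord e p q x) (j : Fin 3) :
    x * p j = 0 ∨ IsWord e p q (x * p j) := by
  cases hx with
  | vertex i =>
    by_cases h : i = j
    · subst h; right; simpa [H.e_mul_p] using IsWord.pqp (e := e) (p := p) (q := q) i 0
    · exact .inl (H.e_mul_p_of_ne h)
  | pq i m =>
    by_cases h : i = j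
    · subst h; exact .inr (.pqp i (m + 1))
    · left; rw [pow_succ, mul_assoc, mul_assoc, H.q_mul_p_of_ne h, mul_zero, mul_zero]
  | qp i m => left; rw [pow_succ, mul_assoc, mul_assoc, H.q_mul_p_mul_p, mul_zero]
  | pqp i m =>
    cases m with
    | zero =>
      by_cases h : j = i + 1
      · subst h; right; rw [pow_zero, one_mul, H.p_mul_p_succ]; exact .qpq _ _
      · left; rw [mul_assoc, H.p_mul_p_of_ne h, mul_zero]
    | succ m => left; rw [pow_succ]; simp only [mul_assoc, H.q_mul_p_mul_p, mul_zero]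
  | qpq i m =>
    by_cases h : i = j
    · subst h; right; rw [mul_assoc, ← pow_succ]; exact .qp i m
    · left; rw [mul_assoc, H.q_mul_p_of_ne h, mul_zero]

lemma isWord_mul_q (H : Relations n e p q) {x : R} (hx : IsWord e p q x) (j : Fin 3) :
    x * q j = 0 ∨ IsWord e p q (x * q j) := by
  cases hx with
  | vertex i =>
    by_cases h : i = j + 1
    · subst h; right; simpa [H.e_mul_q] using IsWord.qpq (e := e) (p := p) (q := q) j 0
    · exact .inl (H.e_mul_q_of_ne h)
  | pq i m => left; rw [pow_succ, mul_assoc, mul_assoc, H.q_mul_q, mul_zero, mul_zero]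
  | qp i m =>
    by_cases h : i = j
    · subst h; exact .inr (.qpq i (m + 1))
    · left; rw [pow_succ, mul_assoc, mul_assoc, H.p_mul_q_of_ne h, mul_zero, mul_zero]
  | pqp i m =>
    by_cases h : i = j
    · subst h; right; rw [mul_assoc, ← pow_succ]; exact .pq i m
    · left; rw [mul_assoc, H.p_mul_q_of_ne h, mul_zero]
  | qpq i m => left; rw [mul_assoc, H.q_mul_q, mul_zero]

lemma finite_isWord (H : Relations n e p q) (hn : ∀ i, 1 ≤ n i) : {x | IsWord e p q x}.Finite := by
  let N := n 0 + n 1 + n 2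
  have hN : ∀ i, n i ≤ N := by intro i; fin_cases i <;> simp [N] <;> omega
  -- The bound `N + 2` is dictated by the family `(q p)^m q`, where `qp_pow_eq_zero` requires `m` to
  -- exceed `n i + 1`.
  let f : Fin 5 × Fin 3 × Fin (N + 2) → R := fun x =>
    ![e x.2.1, (p x.2.1 * q x.2.1) ^ (x.2.2.1 + 1), (q x.2.1 * p x.2.1) ^ (x.2.2.1 + 1),
      (p x.2.1 * q x.2.1) ^ x.2.2.1 * p x.2.1, (q x.2.1 * p x.2.1) ^ x.2.2.1 * q x.2.1] x.1
  refine ((Set.finite_range f).insert 0).subset ?_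
  have key : ∀ (x : R) (m : ℕ) (k : Fin 5) (i : Fin 3), (N + 2 ≤ m → x = 0) →
      (∀ hm : m < N + 2, f (k, i, ⟨m, hm⟩) = x) → x ∈ insert 0 (Set.range f) := by
    intro x m k i h0 h1
    by_cases hm : m < N + 2
    · exact .inr ⟨_, h1 hm⟩
    · exact .inl (h0 (not_lt.1 hm))
  rintro x (i | ⟨i, m⟩ | ⟨i, m⟩ | ⟨i, m⟩ | ⟨i, m⟩)
  · exact key _ 0 0 i (by omega) fun _ => rfl
  · exact key _ m 1 i (fun hm => H.pq_pow_eq_zero hn i (by have := hN i; omega)) fun _ => rfl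
  · exact key _ m 2 i (fun hm => H.qp_pow_eq_zero hn i (by have := hN i; omega)) fun _ => rfl
  · refine key _ m 3 i (fun hm => ?_) fun _ => rfl
    rw [H.pq_pow_eq_zero hn i (by have := hN i; omega), zero_mul]
  · refine key _ m 4 i (fun hm => ?_) fun _ => rfl
    rw [H.qp_pow_eq_zero hn i (by have := hN i; omega), zero_mul]

lemma cycles_commute_p (H : Relations n e p q) (j : Fin 3) :
    p j * ∑ i, (p i * q i + q i * p i) = (∑ i, (p i * q i + q i * p i)) * p j := by
  rw [Finset.mul_sum, Finset.sum_mul]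
  refine Finset.sum_congr rfl fun i _ => ?_
  rw [mul_add, add_mul, H.p_mul_p_mul_q, zero_add, mul_assoc (q i), H.q_mul_p_mul_p, add_zero]
  by_cases h : i = j
  · rw [h, mul_assoc]
  · rw [mul_assoc, H.q_mul_p_of_ne h, mul_zero, ← mul_assoc, H.p_mul_q_of_ne (Ne.symm h), zero_mul]

lemma cycles_commute_q (H : Relations n e p q) (j : Fin 3) :
    q j * ∑ i, (p i * q i + q i * p i) = (∑ i, (p i * q i + q i * p i)) * q j := by
  rw [Finset.mul_sum, Finset.sum_mul]
  refine Finset.sum_congr rfl fun i _ => ?_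
  rw [mul_add, add_mul, ← mul_assoc (q j) (q i), H.q_mul_q, zero_mul, add_zero, mul_assoc (p i),
    H.q_mul_q, mul_zero, zero_add]
  by_cases h : i = j
  · rw [h, mul_assoc]
  · rw [mul_assoc, H.p_mul_q_of_ne h, mul_zero, ← mul_assoc, H.q_mul_p_of_ne (Ne.symm h), zero_mul]

lemma cycles_commute_e (H : Relations n e p q) (j : Fin 3) :
    e j * ∑ i, (p i * q i + q i * p i) = (∑ i, (p i * q i + q i * p i)) * e j := by
  rw [Finset.mul_sum, Finset.sum_mul]
  refine Finset.sum_congr rfl fun i _ => ?_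
  have h1 : e j * (p i * q i) = p i * q i * e j := by
    by_cases h : i = j
    · rw [h, ← mul_assoc, H.e_mul_p, mul_assoc, H.q_mul_e]
    · rw [← mul_assoc, H.e_mul_p_of_ne (Ne.symm h), zero_mul, mul_assoc, H.q_mul_e_of_ne h,
        mul_zero]
  have h2 : e j * (q i * p i) = q i * p i * e j := by
    by_cases h : j = i + 1
    · rw [h, ← mul_assoc, H.e_mul_q, mul_assoc, H.p_mul_e]
    · rw [← mul_assoc, H.e_mul_q_of_ne h, zero_mul, mul_assoc, H.p_mul_e_of_ne h, mul_zero]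
  rw [mul_add, add_mul, h1, h2]

/-- With a factor `p i * q i` present on the right, every summand except `p i * q i` dies; for `m =
0` all the summands would remain. -/
lemma cycles_mul_pq_pow (H : Relations n e p q) (i : Fin 3) {m : ℕ} (hm : 1 ≤ m) :
    (∑ i, (p i * q i + q i * p i)) * (p i * q i) ^ m = (p i * q i) ^ (m + 1) := by
  obtain ⟨m, rfl⟩ : ∃ k, m = k + 1 := ⟨m - 1, by omega⟩
  rw [Finset.sum_mul, Finset.sum_eq_single i]
  · rw [add_mul, pow_succ' _ (m + 1), pow_succ', mul_assoc (q i), ← mul_assoc (p i) (p i * q i),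
      H.p_mul_p_mul_q, zero_mul, mul_zero, add_zero]
  · intro j _ h
    rw [add_mul, pow_succ', mul_assoc (q j), ← mul_assoc (p j) (p i * q i), H.p_mul_p_mul_q,
      zero_mul, mul_zero, add_zero, mul_assoc (p j), ← mul_assoc (q j), ← mul_assoc (q j),
      H.q_mul_p_of_ne h]
    simp
  · simp

/-! ### Classes modulo commutators -/

variable {K : Type*} [Field K] [Algebra K R]

/-- A path that is not closed is a commutator with the idempotent at its end. -/
lemma cl_eq_zero (H : Relations n e p q) {i j : Fin 3} (h : i ≠ j) {x : R}
    (hi : e i * x = x) (hj : x * e j = x) :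
    cl K x = 0 := by
  rw [← hj, cl_mul_comm, ← hi, ← mul_assoc, H.orth j i h.symm, zero_mul, map_zero]

lemma cl_pqp (H : Relations n e p q) (i : Fin 3) (m : ℕ) : cl K ((p i * q i) ^ m * p i) = 0 := by
  refine H.cl_eq_zero (i := i) (j := i + 1) (by simp) ?_ ?_
  · rw [mul_pow_mul_eq, ← mul_assoc, H.e_mul_p]
  · rw [mul_assoc, H.p_mul_e]

lemma cl_qpq (H : Relations n e p q) (i : Fin 3) (m : ℕ) : cl K ((q i * p i) ^ m * q i) = 0 := by
  refine H.cl_eq_zero (i := i + 1) (j := i) (by simp) ?_ ?_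
  · rw [mul_pow_mul_eq, ← mul_assoc, H.e_mul_q]
  · rw [mul_assoc, H.q_mul_e]

/-- The top powers are the three rotations of one three-cycle, and rotation does not change a class.
This accounts for the single `+ 1` in the dimension formula. -/
lemma cl_pq_pow (H : Relations n e p q) (hn : ∀ i, 1 ≤ n i) (i : Fin 3) :
    cl K ((p i * q i) ^ n i) = cl K (p 0 * (p 1 * p 2)) := by
  have h1 : cl K (p 1 * (p 2 * p 0)) = cl K (p 0 * (p 1 * p 2)) := by
    rw [← mul_assoc, cl_mul_comm]
  have h2 : cl K (p 2 * (p 0 * p 1)) = cl K (p 1 * (p 2 * p 0)) := by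
    rw [← mul_assoc, cl_mul_comm]
  rw [H.pq_pow hn]
  fin_cases i
  · rfl
  · exact h1
  · exact h2.trans h1

/-- Among the words only `e i`, the powers of `p i * q i` and the words `(q i * p i)^l * q i` can
have a nonzero product with the cycle. The first gives the scalar, the second raises the exponent,
and the third yields a non-closed path, of class zero. -/
lemma cl_isWord_mul (H : Relations n e p q) {x : R} (hx : IsWord e p q x) (i : Fin 3)
    {m : ℕ} (hm : 1 ≤ m)
    (χ : R →ₐ[K] K) (he : ∀ j, χ (e j) = if j = i then 1 else 0) (hp : ∀ j, χ (p j) = 0)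
    (hq : ∀ j, χ (q j) = 0) :
    cl K (x * (p i * q i) ^ m) - χ x • cl K ((p i * q i) ^ m) ∈ chainSpan p q K i m := by
  obtain ⟨m, rfl⟩ : ∃ k, m = k + 1 := ⟨m - 1, by omega⟩
  have hpp : ∀ j, p j * (p i * q i) ^ (m + 1) = 0 := fun j => by
    rw [pow_succ', ← mul_assoc, H.p_mul_p_mul_q, zero_mul]
  have hqp : ∀ j, j ≠ i → q j * (p i * q i) ^ (m + 1) = 0 := fun j h => by
    rw [pow_succ', ← mul_assoc, ← mul_assoc, H.q_mul_p_of_ne h, zero_mul, zero_mul]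
  cases hx with
  | vertex j =>
    rw [he]
    split_ifs with h
    · rw [h, pow_succ', ← mul_assoc, ← mul_assoc, H.e_mul_p, one_smul, sub_self]
      exact zero_mem _
    · rw [pow_succ', ← mul_assoc, ← mul_assoc, H.e_mul_p_of_ne h]
      simp
  | pq j l =>
    have h0 : χ ((p j * q j) ^ (l + 1)) = 0 := by simp [hp]
    rw [h0, zero_smul, sub_zero]
    by_cases h : j = i
    · rw [h, ← pow_add]
      exact Submodule.subset_span ⟨_, by omega, rfl⟩
    · rw [pow_succ, mul_assoc, mul_assoc, hqp j h]
      simp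
  | qp j l =>
    have h0 : χ ((q j * p j) ^ (l + 1)) = 0 := by simp [hp]
    rw [h0, zero_smul, sub_zero, pow_succ, mul_assoc, mul_assoc, hpp]
    simp
  | pqp j l =>
    rw [map_mul χ, hp, mul_zero, zero_smul, sub_zero, mul_assoc, hpp]
    simp
  | qpq j l =>
    by_cases h : j = i
    · subst h
      have h1 : (q j * p j) ^ l * q j * (p j * q j) ^ (m + 1) =
          (q j * p j) ^ (l + (m + 1)) * q j := by
        rw [mul_assoc, ← mul_pow_mul_eq, pow_add _ l (m + 1), mul_assoc]
      rw [h1, H.cl_qpq, map_mul χ, hq, mul_zero, zero_smul, sub_zero]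
      exact zero_mem _
    · rw [map_mul χ, hq, mul_zero, zero_smul, sub_zero, mul_assoc, hqp j h]
      simp

lemma cl_isWord (H : Relations n e p q) {x : R} (hx : IsWord e p q x)
    (χ : Fin 3 → R →ₐ[K] K) (he : ∀ i j, χ i (e j) = if j = i then 1 else 0)
    (hp : ∀ i j, χ i (p j) = 0) (hq : ∀ i j, χ i (q j) = 0) :
    cl K x - ∑ i, χ i x • cl K (e i) ∈ cycleSpan p q K 0 := by
  cases hx with
  | vertex j => simp [he]
  | pq j l =>
    simp only [map_pow, map_mul, hp, zero_mul, ne_eq, Nat.add_eq_zero_iff, one_ne_zero, and_false,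
      not_false_eq_true, zero_pow, zero_smul, Finset.sum_const_zero, sub_zero]
    exact cl_mem_cycleSpan j (by omega)
  | qp j l =>
    simp only [map_pow, map_mul, hp, mul_zero, ne_eq, Nat.add_eq_zero_iff, one_ne_zero, and_false,
      not_false_eq_true, zero_pow, zero_smul, Finset.sum_const_zero, sub_zero, cl_qp_pow]
    exact cl_mem_cycleSpan j (by omega)
  | pqp j l => simp [hp, H.cl_pqp]
  | qpq j l => simp [hq, H.cl_qpq]

end Relations

end SD3K

namespace SD3K

open Vertex Arrow

/-! ### Generators and relations in cyclic notation -/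

section Generators

variable (K : Type u) [Field K] (n : Fin 3 → ℕ)

/-- The algebra `SD(3K)` with exponents in cyclic notation. -/
abbrev Cyc : Type u := SD3K K (n 0) (n 2) (n 1)

/-- The projection from the free algebra. -/
def proj : Free K →ₐ[K] Cyc K n := RingQuot.mkAlgHom K (Rel K (n 0) (n 2) (n 1))

variable {K n} in
lemma proj_eq {x y : Free K} (h : Rel K (n 0) (n 2) (n 1) x y) : proj K n x = proj K n y :=
  RingQuot.mkAlgHom_rel K h

lemma proj_surjective : Function.Surjective (proj K n) := RingQuot.mkAlgHom_surjective K _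

/-- The idempotents at the vertices. -/
def vtx : Fin 3 → Cyc K n := ![proj K n (e K v0), proj K n (e K v1), proj K n (e K v2)]

/-- The arrows `i → i + 1`. -/
def fwd : Fin 3 → Cyc K n := ![proj K n (ar K β), proj K n (ar K δ), proj K n (ar K lam)]

/-- The arrows `i + 1 → i`. -/
def bwd : Fin 3 → Cyc K n := ![proj K n (ar K γ), proj K n (ar K η), proj K n (ar K κ)]

lemma relations : Relations n (vtx K n) (fwd K n) (bwd K n) where
  idem i := by
    fin_cases i
    · exact (map_mul _ _ _).symm.trans (proj_eq (.idem v0))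
    · exact (map_mul _ _ _).symm.trans (proj_eq (.idem v1))
    · exact (map_mul _ _ _).symm.trans (proj_eq (.idem v2))
  orth i j h := by
    have key : ∀ v w : Vertex, v ≠ w → proj K n (e K v) * proj K n (e K w) = 0 := fun v w hvw =>
      (map_mul _ _ _).symm.trans ((proj_eq (.orth v w hvw)).trans (map_zero _))
    fin_cases i <;> fin_cases j <;> first | exact absurd rfl h | exact key _ _ (by simp)
  unit := by
    have := proj_eq (n := n) (.unit (K := K))
    rwa [map_add, map_add, map_one] at this
  e_mul_p i := by
    fin_cases i
    · exact (map_mul _ _ _).symm.trans (proj_eq (.source β))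
    · exact (map_mul _ _ _).symm.trans (proj_eq (.source δ))
    · exact (map_mul _ _ _).symm.trans (proj_eq (.source lam))
  p_mul_e i := by
    fin_cases i
    · exact (map_mul _ _ _).symm.trans (proj_eq (.target β))
    · exact (map_mul _ _ _).symm.trans (proj_eq (.target δ))
    · exact (map_mul _ _ _).symm.trans (proj_eq (.target lam))
  e_mul_q i := by
    fin_cases i
    · exact (map_mul _ _ _).symm.trans (proj_eq (.source γ))
    · exact (map_mul _ _ _).symm.trans (proj_eq (.source η))
    · exact (map_mul _ _ _).symm.trans (proj_eq (.source κ))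
  q_mul_e i := by
    fin_cases i
    · exact (map_mul _ _ _).symm.trans (proj_eq (.target γ))
    · exact (map_mul _ _ _).symm.trans (proj_eq (.target η))
    · exact (map_mul _ _ _).symm.trans (proj_eq (.target κ))
  q_succ_mul_q i := by
    fin_cases i
    · exact (map_mul _ _ _).symm.trans ((proj_eq .ηγ).trans (map_zero _))
    · exact (map_mul _ _ _).symm.trans ((proj_eq .κη).trans (map_zero _))
    · exact (map_mul _ _ _).symm.trans ((proj_eq .γκ).trans (map_zero _))
  p_mul_p i := by
    fin_cases i
    · exact (map_mul _ _ _).symm.trans ((proj_eq .δlam).trans (by simp [fwd, bwd]))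
    · exact (map_mul _ _ _).symm.trans ((proj_eq .lamβ).trans (by simp [fwd, bwd]))
    · exact (map_mul _ _ _).symm.trans ((proj_eq .βδ).trans (by simp [fwd, bwd]))

variable {K n}

/-- A subspace that contains `1` and is stable under right multiplication by the generators is
everything. -/
lemma eq_top_of_mul_mem (S : Submodule K (Cyc K n)) (one : 1 ∈ S)
    (he : ∀ x ∈ S, ∀ i, x * vtx K n i ∈ S) (hp : ∀ x ∈ S, ∀ i, x * fwd K n i ∈ S)
    (hq : ∀ x ∈ S, ∀ i, x * bwd K n i ∈ S) : S = ⊤ := by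
  have key : ∀ f : Free K, ∀ x ∈ S, x * proj K n f ∈ S := by
    intro f
    induction f using FreeAlgebra.induction with
    | grade0 r =>
      intro x hx
      rw [AlgHom.commutes, ← Algebra.commutes, ← Algebra.smul_def]
      exact S.smul_mem r hx
    | grade1 g =>
      intro x hx
      rcases g with v | a
      · cases v
        exacts [he x hx 0, he x hx 1, he x hx 2]
      · cases a
        exacts [hp x hx 0, hq x hx 0, hp x hx 1, hq x hx 1, hp x hx 2, hq x hx 2]
    | mul f g hf hg =>
      intro x hx
      rw [map_mul, ← mul_assoc]
      exact hg _ (hf _ hx)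
    | add f g hf hg =>
      intro x hx
      rw [map_add, mul_add]
      exact S.add_mem (hf _ hx) (hg _ hx)
  refine eq_top_iff.2 fun x _ => ?_
  obtain ⟨f, rfl⟩ := proj_surjective K n x
  simpa using key f 1 one

lemma span_isWord :
    Submodule.span K {x | IsWord (vtx K n) (fwd K n) (bwd K n) x} = ⊤ := by
  have H := relations K n
  have stable : ∀ y : Cyc K n, (∀ x, IsWord (vtx K n) (fwd K n) (bwd K n) x → x * y = 0 ∨
      IsWord (vtx K n) (fwd K n) (bwd K n) (x * y)) →
      ∀ x ∈ Submodule.span K {x | IsWord (vtx K n) (fwd K n) (bwd K n) x},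
        x * y ∈ Submodule.span K {x | IsWord (vtx K n) (fwd K n) (bwd K n) x} := by
    intro y hy x hx
    refine (show _ ≤ (Submodule.span K {x | IsWord (vtx K n) (fwd K n) (bwd K n) x}).comap
      (LinearMap.mulRight K y) from Submodule.span_le.2 fun w hw => ?_) hx
    rcases hy w hw with h | h
    · simp [h]
    · exact Submodule.subset_span h
  refine eq_top_of_mul_mem _ ?_ (fun x hx i => stable _ (fun w hw => H.isWord_mul_e hw i) x hx)
    (fun x hx i => stable _ (fun w hw => H.isWord_mul_p hw i) x hx)
    (fun x hx i => stable _ (fun w hw => H.isWord_mul_q hw i) x hx)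
  rw [← H.unit]
  exact add_mem (add_mem (Submodule.subset_span (.vertex _)) (Submodule.subset_span (.vertex _)))
    (Submodule.subset_span (.vertex _))

lemma finite (hn : ∀ i, 1 ≤ n i) : Module.Finite K (Cyc K n) :=
  ⟨Submodule.fg_def.2 ⟨_, (relations K n).finite_isWord hn, span_isWord⟩⟩

/-- The images of the generators of the free algebra. -/
def genMap {R : Type*} (e p q : Fin 3 → R) : Vertex ⊕ Arrow → R :=
  Sum.elim (fun v => match v with | v0 => e 0 | v1 => e 1 | v2 => e 2)
    (fun a => match a with
      | β => p 0 | δ => p 1 | lam => p 2 | γ => q 0 | η => q 1 | κ => q 2)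

/-- The homomorphism defined by elements that satisfy the relations. -/
def lift {R : Type*} [Ring R] [Algebra K R] {e p q : Fin 3 → R} (H : Relations n e p q) :
    Cyc K n →ₐ[K] R :=
  RingQuot.liftAlgHom K ⟨FreeAlgebra.lift K (genMap e p q), by
    have hf : ∀ g, FreeAlgebra.lift K (genMap e p q) (FreeAlgebra.ι K g) = genMap e p q g :=
      FreeAlgebra.lift_ι_apply _
    intro x y h
    cases h with
    | idem v => cases v <;> simp [SD3K.e, genMap, H.idem]
    | orth v w h =>
      cases v <;> cases w <;> first | exact absurd rfl h | simp [SD3K.e, genMap, H.orth]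
    | unit => simp [SD3K.e, genMap, H.unit]
    | source a =>
      simp only [map_mul, SD3K.e, ar, hf]
      cases a
      exacts [H.e_mul_p 0, H.e_mul_q 0, H.e_mul_p 1, H.e_mul_q 1, H.e_mul_p 2, H.e_mul_q 2]
    | target a =>
      simp only [map_mul, SD3K.e, ar, hf]
      cases a
      exacts [H.p_mul_e 0, H.q_mul_e 0, H.p_mul_e 1, H.q_mul_e 1, H.p_mul_e 2, H.q_mul_e 2]
    | κη =>
      simp only [map_mul, map_zero, ar, hf]
      exact H.q_mul_q 2 1
    | ηγ =>
      simp only [map_mul, map_zero, ar, hf]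
      exact H.q_mul_q 1 0
    | γκ =>
      simp only [map_mul, map_zero, ar, hf]
      exact H.q_mul_q 0 2
    | δlam =>
      simp only [map_mul, map_pow, ar, hf]
      exact H.p_mul_p 0
    | βδ =>
      simp only [map_mul, map_pow, ar, hf]
      exact H.p_mul_p 2
    | lamβ =>
      simp only [map_mul, map_pow, ar, hf]
      exact H.p_mul_p 1⟩

section

variable {R : Type*} [Ring R] [Algebra K R] {e p q : Fin 3 → R} (H : Relations n e p q)

lemma lift_proj_ι (g : Vertex ⊕ Arrow) :
    lift (K := K) H (proj K n (FreeAlgebra.ι K g)) = genMap e p q g :=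
  (RingQuot.liftAlgHom_mkAlgHom_apply K _ _ _).trans (FreeAlgebra.lift_ι_apply _ _)

lemma lift_vtx (i : Fin 3) : lift (K := K) H (vtx K n i) = e i := by
  fin_cases i <;> exact lift_proj_ι H _

lemma lift_fwd (i : Fin 3) : lift (K := K) H (fwd K n i) = p i := by
  fin_cases i <;> exact lift_proj_ι H _

lemma lift_bwd (i : Fin 3) : lift (K := K) H (bwd K n i) = q i := by
  fin_cases i <;> exact lift_proj_ι H _

end

/-- The character at a vertex. -/
def vtxChar (i : Fin 3) : Cyc K n →ₐ[K] K :=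
  lift (e := fun j => if j = i then 1 else 0) (p := 0) (q := 0)
    { idem := by simp
      orth := fun j k h => by
        by_cases hj : j = i
        · subst hj; simp [h.symm]
        · simp [hj]
      unit := by fin_cases i <;> simp
      e_mul_p := by simp
      p_mul_e := by simp
      e_mul_q := by simp
      q_mul_e := by simp
      q_succ_mul_q := by simp
      p_mul_p := by simp }

lemma vtxChar_vtx (i j : Fin 3) :
    vtxChar (K := K) (n := n) i (vtx K n j) = if j = i then 1 else 0 :=
  lift_vtx _ j

lemma vtxChar_fwd (i j : Fin 3) : vtxChar (K := K) (n := n) i (fwd K n j) = 0 := lift_fwd _ j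

lemma vtxChar_bwd (i j : Fin 3) : vtxChar (K := K) (n := n) i (bwd K n j) = 0 := lift_bwd _ j

/-! ### The filtration of the zeroth Hochschild homology by powers of two-cycles -/

variable (K n) in
/-- The span of the classes of the powers of exponent larger than `k` of the two-cycles. -/
abbrev cyc (k : ℕ) : Submodule K (HochschildZero K (Cyc K n)) := cycleSpan (fwd K n) (bwd K n) K k

lemma cl_sub_mem (x : Cyc K n) :
    cl K x - ∑ i, vtxChar i x • cl K (vtx K n i) ∈ cyc K n 0 := by
  let f : Cyc K n →ₗ[K] HochschildZero K (Cyc K n) :=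
    cl K - ∑ i, (vtxChar i).toLinearMap.smulRight (cl K (vtx K n i))
  have hf : ∀ x, f x = cl K x - ∑ i, vtxChar i x • cl K (vtx K n i) := fun x => by simp [f]
  have : (⊤ : Submodule K (Cyc K n)) ≤ (cyc K n 0).comap f := by
    rw [← span_isWord]
    refine Submodule.span_le.2 fun w hw => ?_
    change f w ∈ cyc K n 0
    rw [hf]
    exact (relations K n).cl_isWord hw vtxChar vtxChar_vtx vtxChar_fwd vtxChar_bwd
  rw [← hf]
  exact this trivial

lemma cl_mul_pow_sub_mem (x : Cyc K n) (i : Fin 3) {m : ℕ} (hm : 1 ≤ m) :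
    cl K (x * (fwd K n i * bwd K n i) ^ m) -
      vtxChar i x • cl K ((fwd K n i * bwd K n i) ^ m) ∈ chainSpan (fwd K n) (bwd K n) K i m := by
  let f : Cyc K n →ₗ[K] HochschildZero K (Cyc K n) :=
    cl K ∘ₗ LinearMap.mulRight K ((fwd K n i * bwd K n i) ^ m) -
      (vtxChar i).toLinearMap.smulRight (cl K ((fwd K n i * bwd K n i) ^ m))
  have : (⊤ : Submodule K (Cyc K n)) ≤ (chainSpan (fwd K n) (bwd K n) K i m).comap f := by
    rw [← span_isWord]
    exact Submodule.span_le.2 fun w hw => (relations K n).cl_isWord_mul hw i hm (vtxChar i)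
      (vtxChar_vtx i) (vtxChar_fwd i) (vtxChar_bwd i)
  exact this (show x ∈ _ from trivial)

lemma mem_cyc_zero {h : HochschildZero K (Cyc K n)} (hh : ∀ χ, char χ h = 0) : h ∈ cyc K n 0 := by
  obtain ⟨x, rfl⟩ := cl_surjective h
  have h0 : ∑ i, vtxChar i x • cl K (vtx K n i) = 0 :=
    Finset.sum_eq_zero fun i _ => by
      have := hh (vtxChar i)
      rw [char_cl] at this
      rw [this, zero_smul]
  simpa [h0] using cl_sub_mem x

/-- Characters vanish on nilpotents, and the three vertex characters already remove the idempotent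
part of a class; conversely the two-cycles are nilpotent. -/
lemma nilSpan_eq (hn : ∀ i, 1 ≤ n i) : nilSpan K (Cyc K n) = cyc K n 0 := by
  refine le_antisymm (fun h hh => mem_cyc_zero fun χ => char_eq_zero_of_mem_nilSpan χ hh) ?_
  refine Submodule.span_le.2 ?_
  rintro _ ⟨i, m, hm, rfl⟩
  exact cl_mem_nilSpan (((relations K n).isNilpotent_pq hn i).pow_of_pos hm.ne')

lemma mem_nilSpan (hn : ∀ i, 1 ≤ n i) (h : HochschildZero K (Cyc K n))
    (hh : ∀ χ, char χ h = 0) : h ∈ nilSpan K (Cyc K n) :=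
  nilSpan_eq (K := K) hn ▸ mem_cyc_zero hh

lemma cyc_antitone {k l : ℕ} (h : k ≤ l) : cyc K n l ≤ cyc K n k := by
  refine Submodule.span_mono ?_
  rintro _ ⟨i, m, hm, rfl⟩
  exact ⟨i, m, by omega, rfl⟩

lemma cyc_eq_bot (hn : ∀ i, 1 ≤ n i) {k : ℕ} (hk : ∀ i, n i ≤ k) : cyc K n k = ⊥ := by
  refine Submodule.span_eq_bot.2 ?_
  rintro _ ⟨i, m, hm, rfl⟩
  rw [(relations K n).pq_pow_eq_zero hn i ((hk i).trans_lt hm), map_zero]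

/-- By `cl_mul_pow_sub_mem`, the leading coefficient of the action of `w` on a power of the cycle at
`i` is the character of `w` at `i`. -/
lemma centerMul_mem_cyc {w : Subalgebra.center K (Cyc K n)}
    (hw : ∀ i, vtxChar i (w : Cyc K n) = 0) {k : ℕ} {h : HochschildZero K (Cyc K n)}
    (hh : h ∈ cyc K n k) : centerMul w h ∈ cyc K n (k + 1) := by
  refine (show cyc K n k ≤ (cyc K n (k + 1)).comap (centerMul w) from
    Submodule.span_le.2 ?_) hh
  rintro _ ⟨i, m, hm, rfl⟩
  have := cl_mul_pow_sub_mem (w : Cyc K n) i (show 1 ≤ m by omega)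
  rw [hw, zero_smul, sub_zero] at this
  exact cyc_antitone (by omega) (chainSpan_le_cycleSpan i m this)

variable (K n) in
/-- The sum of the two-cycles, as an element of the centre. -/
def cycles : Subalgebra.center K (Cyc K n) :=
  ⟨∑ i, (fwd K n i * bwd K n i + bwd K n i * fwd K n i), by
    have H := relations K n
    let z : Cyc K n := ∑ i, (fwd K n i * bwd K n i + bwd K n i * fwd K n i)
    let S : Submodule K (Cyc K n) :=
      LinearMap.eqLocus (LinearMap.mulRight K z) (LinearMap.mulLeft K z)
    have hS : ∀ x, x ∈ S ↔ x * z = z * x := fun x => Iff.rfl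
    have mul : ∀ x ∈ S, ∀ y, y * z = z * y → x * y ∈ S := by
      intro x hx y hy
      rw [hS] at hx ⊢
      rw [mul_assoc, hy, ← mul_assoc, hx, mul_assoc]
    have hS' : S = ⊤ := eq_top_of_mul_mem S ((hS 1).2 (by rw [one_mul, mul_one]))
      (fun x hx i => mul x hx _ (H.cycles_commute_e i))
      (fun x hx i => mul x hx _ (H.cycles_commute_p i))
      (fun x hx i => mul x hx _ (H.cycles_commute_q i))
    exact Subalgebra.mem_center_iff.2 fun x => (hS x).1 (hS' ▸ trivial)⟩

lemma centerMul_cycles_cl (i : Fin 3) {m : ℕ} (hm : 1 ≤ m) :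
    centerMul (cycles K n) (cl K ((fwd K n i * bwd K n i) ^ m)) =
      cl K ((fwd K n i * bwd K n i) ^ (m + 1)) := by
  rw [centerMul_cl]
  exact congrArg _ ((relations K n).cycles_mul_pq_pow i hm)

lemma vtxChar_cycles (i : Fin 3) : vtxChar i (cycles K n : Cyc K n) = 0 := by
  simp [cycles, vtxChar_fwd, vtxChar_bwd]

/-- Central elements act on the class of the socle by scalars. -/
lemma centerMul_cl_pq_pow (hn : ∀ i, 1 ≤ n i) (w : Subalgebra.center K (Cyc K n)) (i : Fin 3) :
    centerMul w (cl K ((fwd K n i * bwd K n i) ^ n i)) =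
      vtxChar i (w : Cyc K n) • cl K ((fwd K n i * bwd K n i) ^ n i) := by
  have h := cl_mul_pow_sub_mem (w : Cyc K n) i (hn i)
  have h0 : chainSpan (fwd K n) (bwd K n) K i (n i) = ⊥ := by
    refine Submodule.span_eq_bot.2 ?_
    rintro _ ⟨m, hm, rfl⟩
    rw [(relations K n).pq_pow_eq_zero hn i hm, map_zero]
  rw [h0, Submodule.mem_bot, sub_eq_zero] at h
  exact h

end Generators

end SD3K

namespace SD3K

/-! ### A commutative model that detects the classes of the two-cycles -/

section Matrix

variable {R : Type*} [CommRing R] {n : Fin 3 → ℕ}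

lemma single_mul_single_pow (i j : Fin 3) (x y : R) (m : ℕ) :
    (Matrix.single i j x * Matrix.single j i y) ^ (m + 1) =
      Matrix.single i i ((x * y) ^ (m + 1)) := by
  induction m with
  | zero => simp
  | succ m ih => rw [pow_succ, ih, Matrix.single_mul_single_same, Matrix.single_mul_single_same,
      ← pow_succ]

/-- Commuting elements that satisfy the relations define a representation by matrices. -/
lemma matrixRelations {p q : Fin 3 → R} (hq : ∀ i, q (i + 1) * q i = 0)
    (hp : ∀ i, p (i + 1) * p (i + 2) = (q i * p i) ^ (n i - 1) * q i) :
    Relations n (fun i => Matrix.single i i (1 : R)) (fun i => Matrix.single i (i + 1) (p i))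
      (fun i => Matrix.single (i + 1) i (q i)) where
  idem i := by simp
  orth i j h := Matrix.single_mul_single_of_ne _ _ _ _ h _
  unit := by
    ext i j
    fin_cases i <;> fin_cases j <;> simp [Matrix.single]
  e_mul_p i := by simp
  p_mul_e i := by simp
  e_mul_q i := by simp
  q_mul_e i := by simp
  q_succ_mul_q i := by simp [hq]
  p_mul_p i := by
    have h : ∀ i : Fin 3, i + 2 + 1 = i := by decide
    have h' : ∀ i : Fin 3, i + 1 + 1 = i + 2 := by decide
    rw [h, h', Matrix.single_mul_single_same, hp]
    rcases n i - 1 with _ | m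
    · simp
    · rw [single_mul_single_pow, Matrix.single_mul_single_same]

end Matrix

section Model

open MvPolynomial

variable (K : Type u) [Field K] (n : Fin 3 → ℕ)

/-- The exponent of the two-cycle at `i`. -/
def cycExp (i : Fin 3) : Fin 3 × Bool →₀ ℕ :=
  Finsupp.single (i, false) 1 + Finsupp.single (i, true) 1

/-- The exponent of the three-cycle. -/
def triExp : Fin 3 × Bool →₀ ℕ := ∑ i, Finsupp.single (i, false) 1

lemma cycExp_false (i j : Fin 3) : cycExp i (j, false) = if i = j then 1 else 0 := by
  simp [cycExp, Finsupp.single_apply]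

lemma cycExp_true (i j : Fin 3) : cycExp i (j, true) = if i = j then 1 else 0 := by
  simp [cycExp, Finsupp.single_apply]

lemma triExp_false (j : Fin 3) : triExp (j, false) = 1 := by
  simp [triExp, Finsupp.single_apply]

lemma triExp_true (j : Fin 3) : triExp (j, true) = 0 := by
  simp [triExp]

/-- The ideal of relations of the commutative model. -/
def modelIdeal : Ideal (MvPolynomial (Fin 3 × Bool) K) :=
  Ideal.span (Set.range (fun i : Fin 3 =>
      (monomial (Finsupp.single (i + 1, true) 1 + Finsupp.single (i, true) 1) (1 : K))) ∪
    Set.range (fun i : Fin 3 =>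
      monomial (Finsupp.single (i + 1, false) 1 + Finsupp.single (i + 2, false) 1) (1 : K) -
        monomial ((n i - 1) • cycExp i + Finsupp.single (i, true) 1) (1 : K)))

variable {K n}

lemma not_bb_le_smul_cycExp (i j : Fin 3) (m : ℕ) :
    ¬ (Finsupp.single (j + 1, true) 1 + Finsupp.single (j, true) 1 : Fin 3 × Bool →₀ ℕ) ≤
      m • cycExp i := by
  intro h
  have h1 := h (j + 1, true)
  have h2 := h (j, true)
  simp only [Finsupp.add_apply, Finsupp.smul_apply, cycExp_true, Finsupp.single_apply] at h1 h2
  by_cases hi : i = j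
  · subst hi; simp at h1
  · simp [hi] at h2

lemma not_ff_le_smul_cycExp (i j : Fin 3) (m : ℕ) :
    ¬ (Finsupp.single (j + 1, false) 1 + Finsupp.single (j + 2, false) 1 : Fin 3 × Bool →₀ ℕ) ≤
      m • cycExp i := by
  intro h
  have h1 := h (j + 1, false)
  have h2 := h (j + 2, false)
  simp only [Finsupp.add_apply, Finsupp.smul_apply, cycExp_false, Finsupp.single_apply] at h1 h2
  by_cases hi : i = j + 1
  · subst hi; simp at h2
  · simp [hi] at h1

lemma le_of_long_le_smul_cycExp (hn : ∀ i, 1 ≤ n i) {i j : Fin 3} {m : ℕ}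
    (h : (n j - 1) • cycExp j + Finsupp.single (j, true) 1 ≤ m • cycExp i) : i = j ∧ n i ≤ m := by
  have h1 := h (j, true)
  simp only [Finsupp.add_apply, Finsupp.smul_apply, cycExp_true, Finsupp.single_apply] at h1
  by_cases hi : i = j
  · subst hi
    have := hn i
    simp at h1
    exact ⟨rfl, by omega⟩
  · simp [hi] at h1

lemma long_add (hn : ∀ i, 1 ≤ n i) (i : Fin 3) :
    n i • cycExp i =
      (n i - 1) • cycExp i + Finsupp.single (i, true) 1 + Finsupp.single (i, false) 1 := by
  have h := hn i
  conv_lhs => rw [← Nat.sub_add_cancel h, add_smul, one_smul]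
  rw [cycExp]
  abel

lemma tri_add (j : Fin 3) : triExp =
    Finsupp.single (j + 1, false) 1 + Finsupp.single (j + 2, false) 1 +
      Finsupp.single (j, false) 1 := by
  rw [triExp, Fin.sum_univ_three]
  fin_cases j
  · simp; abel
  · simp; abel
  · simp

/-- A functional that is compatible with the relations vanishes on the ideal. -/
lemma modelIdeal_le_ker (φ : MvPolynomial (Fin 3 × Bool) K →ₗ[K] K)
    (hb : ∀ (i : Fin 3) f, φ (monomial (Finsupp.single (i + 1, true) 1 +
      Finsupp.single (i, true) 1) (1 : K) * f) = 0)
    (hf : ∀ (i : Fin 3) f, φ (monomial (Finsupp.single (i + 1, false) 1 +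
        Finsupp.single (i + 2, false) 1) (1 : K) * f) =
      φ (monomial ((n i - 1) • cycExp i + Finsupp.single (i, true) 1) (1 : K) * f)) :
    (modelIdeal K n).restrictScalars K ≤ LinearMap.ker φ := by
  intro x hx
  have key : ∀ f, φ (x * f) = 0 := by
    refine Submodule.span_induction (p := fun x _ => ∀ f, φ (x * f) = 0) ?_ ?_ ?_ ?_ hx
    · rintro _ (⟨i, rfl⟩ | ⟨i, rfl⟩) f
      · exact hb i f
      · rw [sub_mul, map_sub, hf, sub_self]
    · intro f
      rw [zero_mul, map_zero]
    · intro x y _ _ h1 h2 f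
      rw [add_mul, map_add, h1, h2, add_zero]
    · intro a x _ h f
      rw [smul_eq_mul, mul_comm a, mul_assoc]
      exact h _
  simpa using key 1

variable (K n) in
/-- The coefficient of the `m`-th power of a two-cycle. -/
def cycCoeff (i : Fin 3) (m : ℕ) : MvPolynomial (Fin 3 × Bool) K →ₗ[K] K :=
  lcoeff K (m • cycExp i)

variable (K n) in
/-- The functional that takes the value `1` on the three-cycle. -/
def triCoeff : MvPolynomial (Fin 3 × Bool) K →ₗ[K] K :=
  lcoeff K triExp + ∑ i, lcoeff K (n i • cycExp i)

lemma modelIdeal_le_ker_cycCoeff (hn : ∀ i, 1 ≤ n i) (i : Fin 3) {m : ℕ} (hm : m < n i) :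
    (modelIdeal K n).restrictScalars K ≤ LinearMap.ker (cycCoeff K i m) := by
  refine modelIdeal_le_ker _ (fun j f => ?_) (fun j f => ?_)
  · rw [cycCoeff, lcoeff_apply, coeff_monomial_mul', if_neg (not_bb_le_smul_cycExp i j m)]
  · rw [cycCoeff, lcoeff_apply, lcoeff_apply, coeff_monomial_mul', coeff_monomial_mul',
      if_neg (not_ff_le_smul_cycExp i j m), if_neg]
    intro h
    have := (le_of_long_le_smul_cycExp hn h).2
    omega

/-- Both monomials of the `j`-th binomial relation reach a monomial seen by `triCoeff` through the
same cofactor, the variable `(j, false)`: one gives the three-cycle, the other the full power of the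
two-cycle. The two contributions therefore agree. -/
lemma modelIdeal_le_ker_triCoeff (hn : ∀ i, 1 ≤ n i) :
    (modelIdeal K n).restrictScalars K ≤ LinearMap.ker (triCoeff K n) := by
  refine modelIdeal_le_ker _ (fun j f => ?_) (fun j f => ?_)
  · simp only [triCoeff, LinearMap.add_apply, LinearMap.sum_apply, lcoeff_apply,
      coeff_monomial_mul', not_bb_le_smul_cycExp, if_false, Finset.sum_const_zero, add_zero]
    rw [if_neg]
    intro h
    have := h (j, true)
    simp [triExp_true] at this
  · simp only [triCoeff, LinearMap.add_apply, LinearMap.sum_apply, lcoeff_apply,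
      coeff_monomial_mul', not_ff_le_smul_cycExp, if_false, Finset.sum_const_zero, add_zero]
    have hlong : ¬ (n j - 1) • cycExp j + Finsupp.single (j, true) 1 ≤ triExp := fun h => by
      have := h (j, true)
      simp [triExp_true] at this
    rw [if_neg hlong, Finset.sum_eq_single j, tri_add j, long_add hn j, if_pos, if_pos,
      add_tsub_cancel_left, add_tsub_cancel_left, zero_add]
    · exact le_self_add
    · exact le_self_add
    · intro i _ hi
      rw [if_neg]
      intro h
      exact hi (le_of_long_le_smul_cycExp hn h).1
    · simp

lemma smul_cycExp_ne (i j : Fin 3) {m l : ℕ} (hm : 1 ≤ m) (h : i ≠ j ∨ m ≠ l) :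
    m • cycExp i ≠ l • cycExp j := by
  intro h'
  have h1 := DFunLike.congr_fun h' (i, true)
  simp only [Finsupp.smul_apply, cycExp_true] at h1
  by_cases hij : j = i
  · simp [hij] at h1
    rcases h with h | h
    · exact h hij.symm
    · exact h h1
  · simp [hij] at h1
    omega

lemma smul_cycExp_ne_triExp (i : Fin 3) (m : ℕ) : m • cycExp i ≠ triExp := by
  intro h
  have h1 := DFunLike.congr_fun h (i + 1, false)
  simp [cycExp_false, triExp_false] at h1

lemma cycCoeff_cyc (i j : Fin 3) {m l : ℕ} (hm : 1 ≤ m) :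
    cycCoeff K i m (monomial (l • cycExp j) 1) = if i = j ∧ m = l then 1 else 0 := by
  rw [cycCoeff, lcoeff_apply, coeff_monomial]
  by_cases h : i = j ∧ m = l
  · rw [if_pos h, if_pos (by rw [h.1, h.2])]
  · rw [if_neg h, if_neg (smul_cycExp_ne i j hm (by tauto)).symm]

lemma cycCoeff_tri (i : Fin 3) (m : ℕ) : cycCoeff K i m (monomial triExp 1) = 0 := by
  rw [cycCoeff, lcoeff_apply, coeff_monomial, if_neg (smul_cycExp_ne_triExp i m).symm]

lemma triCoeff_cyc (j : Fin 3) {l : ℕ} (hl : 1 ≤ l) (hl' : l < n j) :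
    triCoeff K n (monomial (l • cycExp j) 1) = 0 := by
  simp only [triCoeff, LinearMap.add_apply, LinearMap.sum_apply, lcoeff_apply, coeff_monomial]
  rw [if_neg (smul_cycExp_ne_triExp j l), Finset.sum_eq_zero, add_zero]
  intro i _
  rw [if_neg (smul_cycExp_ne j i hl _)]
  by_cases h : j = i
  · subst h; right; omega
  · exact .inl h

lemma triCoeff_tri : triCoeff K n (monomial triExp 1) = 1 := by
  simp only [triCoeff, LinearMap.add_apply, LinearMap.sum_apply, lcoeff_apply, coeff_monomial,
    if_true]
  rw [Finset.sum_eq_zero, add_zero]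
  intro i _
  rw [if_neg (smul_cycExp_ne_triExp i _).symm]

end Model

end SD3K

namespace SD3K

/-! ### Linear independence of the classes and dimensions of the filtration. -/

section Detection

open MvPolynomial

variable (K : Type u) [Field K] (n : Fin 3 → ℕ)

/-- The commutative model. -/
abbrev Model : Type u := MvPolynomial (Fin 3 × Bool) K ⧸ modelIdeal K n

lemma modelRelations : Relations n (fun i => Matrix.single i i (1 : Model K n))
    (fun i => Matrix.single i (i + 1) (Ideal.Quotient.mk (modelIdeal K n) (X (i, false))))
    (fun i => Matrix.single (i + 1) i (Ideal.Quotient.mk (modelIdeal K n) (X (i, true)))) := by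
  refine matrixRelations (fun i => ?_) (fun i => ?_)
  · rw [← map_mul, Ideal.Quotient.eq_zero_iff_mem]
    refine Ideal.subset_span (.inl ⟨i, ?_⟩)
    simp [X, monomial_mul]
  · simp only [← map_mul, ← map_pow]
    rw [Ideal.Quotient.eq]
    refine Ideal.subset_span (.inr ⟨i, ?_⟩)
    simp [X, monomial_mul, monomial_pow, cycExp, add_comm]

/-- The trace of the matrix representation over the commutative model. -/
def modelTrace : HochschildZero K (Cyc K n) →ₗ[K] Model K n :=
  HochschildZero.lift
    (Matrix.traceLinearMap (Fin 3) K (Model K n) ∘ₗ (lift (modelRelations K n)).toLinearMap)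
    fun u v => by
      simp only [LinearMap.comp_apply, AlgHom.toLinearMap_apply, map_mul (lift _),
        Matrix.traceLinearMap_apply]
      exact Matrix.trace_mul_comm _ _

lemma modelTrace_cyc (i : Fin 3) (m : ℕ) :
    modelTrace K n (cl K ((fwd K n i * bwd K n i) ^ (m + 1))) =
      Ideal.Quotient.mk (modelIdeal K n) (monomial ((m + 1) • cycExp i) 1) := by
  rw [modelTrace, HochschildZero.lift_cl, LinearMap.comp_apply, AlgHom.toLinearMap_apply, map_pow,
    map_mul, lift_fwd, lift_bwd, single_mul_single_pow, Matrix.traceLinearMap_apply,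
    Matrix.trace_single_eq_same, ← map_mul, ← map_pow]
  simp [X, monomial_mul, monomial_pow, cycExp]

lemma modelTrace_tri :
    modelTrace K n (cl K (fwd K n 0 * (fwd K n 1 * fwd K n 2))) =
      Ideal.Quotient.mk (modelIdeal K n) (monomial triExp 1) := by
  rw [modelTrace, HochschildZero.lift_cl, LinearMap.comp_apply, AlgHom.toLinearMap_apply,
    map_mul (lift _), map_mul (lift _), lift_fwd, lift_fwd, lift_fwd]
  have h1 : (0 : Fin 3) + 1 = 1 := rfl
  have h2 : (1 : Fin 3) + 1 = 2 := rfl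
  have h3 : (2 : Fin 3) + 1 = 0 := rfl
  rw [h1, h2, h3, Matrix.single_mul_single_same, Matrix.single_mul_single_same,
    Matrix.traceLinearMap_apply, Matrix.trace_single_eq_same, ← map_mul, ← map_mul]
  simp [X, monomial_mul, triExp, Fin.sum_univ_three, add_assoc]

variable {K n}

/-- The functional on `A / [A, A]` induced by a functional on the polynomial ring. -/
def modelFunctional (φ : MvPolynomial (Fin 3 × Bool) K →ₗ[K] K)
    (hφ : (modelIdeal K n).restrictScalars K ≤ LinearMap.ker φ) :
    HochschildZero K (Cyc K n) →ₗ[K] K :=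
  ((modelIdeal K n).restrictScalars K).liftQ φ hφ ∘ₗ
    (Submodule.Quotient.restrictScalarsEquiv K (modelIdeal K n)).symm.toLinearMap ∘ₗ
      modelTrace K n

lemma modelFunctional_of_eq {φ : MvPolynomial (Fin 3 × Bool) K →ₗ[K] K}
    (hφ : (modelIdeal K n).restrictScalars K ≤ LinearMap.ker φ)
    {h : HochschildZero K (Cyc K n)} {f : MvPolynomial (Fin 3 × Bool) K}
    (hf : modelTrace K n h = Ideal.Quotient.mk (modelIdeal K n) f) :
    modelFunctional φ hφ h = φ f := by
  rw [modelFunctional, LinearMap.comp_apply, LinearMap.comp_apply, hf]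
  rfl

variable (K n) in
/-- A basis of `cyc K n k`, if one of the exponents is larger than `k`. -/
def cycFamily (k : ℕ) : Option (Σ i : Fin 3, Fin (n i - 1 - k)) → HochschildZero K (Cyc K n)
  | none => cl K (fwd K n 0 * (fwd K n 1 * fwd K n 2))
  | some x => cl K ((fwd K n x.1 * bwd K n x.1) ^ (k + x.2 + 1))

/-- The coefficient functionals on the commutative model, pulled back along the matrix trace, form a
dual family. Exponents stay below `n i`, since the full power is already represented by the
three-cycle. -/
lemma linearIndependent_cycFamily (hn : ∀ i, 1 ≤ n i) (k : ℕ) :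
    LinearIndependent K (cycFamily K n k) := by
  have hlt : ∀ x : Σ i : Fin 3, Fin (n i - 1 - k), k + x.2 + 1 < n x.1 := fun x => by
    have := x.2.2
    omega
  refine LinearIndependent.of_pairwise_dual_eq_zero_one _ (fun x => match x with
    | none => modelFunctional _ (modelIdeal_le_ker_triCoeff hn)
    | some x => modelFunctional _ (modelIdeal_le_ker_cycCoeff hn x.1 (hlt x))) ?_ ?_
  · rintro (_ | x) (_ | y) hxy
    · exact absurd rfl hxy
    · exact (modelFunctional_of_eq _ (modelTrace_cyc K n _ _)).trans
        (triCoeff_cyc _ (by omega) (hlt y))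
    · exact (modelFunctional_of_eq _ (modelTrace_tri K n)).trans (cycCoeff_tri _ _)
    · refine (modelFunctional_of_eq _ (modelTrace_cyc K n _ _)).trans ?_
      rw [cycCoeff_cyc _ _ (by omega), if_neg]
      rintro ⟨h1, h2⟩
      obtain ⟨i, a⟩ := x
      obtain ⟨j, b⟩ := y
      obtain rfl : i = j := h1
      obtain rfl : a = b := by
        ext
        simp only at h2
        omega
      exact hxy rfl
  · rintro (_ | x)
    · exact (modelFunctional_of_eq _ (modelTrace_tri K n)).trans triCoeff_tri
    · refine (modelFunctional_of_eq _ (modelTrace_cyc K n _ _)).trans ?_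
      rw [cycCoeff_cyc _ _ (by omega), if_pos ⟨rfl, rfl⟩]

lemma cl_pq_pow_ne_zero (hn : ∀ i, 1 ≤ n i) (i : Fin 3) :
    cl K ((fwd K n i * bwd K n i) ^ n i) ≠ 0 := by
  rw [(relations K n).cl_pq_pow hn]
  exact (linearIndependent_cycFamily hn 0).ne_zero none

lemma span_cycFamily (hn : ∀ i, 1 ≤ n i) {k : ℕ} (hk : ∃ i, k < n i) :
    Submodule.span K (Set.range (cycFamily K n k)) = cyc K n k := by
  refine le_antisymm (Submodule.span_le.2 ?_) (Submodule.span_le.2 ?_)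
  · rintro _ ⟨_ | x, rfl⟩
    · obtain ⟨i, hi⟩ := hk
      change cl K (fwd K n 0 * (fwd K n 1 * fwd K n 2)) ∈ cyc K n k
      rw [← (relations K n).cl_pq_pow hn i]
      exact cl_mem_cycleSpan i hi
    · exact cl_mem_cycleSpan x.1 (by omega)
  · rintro _ ⟨i, m, hm, rfl⟩
    rcases lt_trichotomy m (n i) with h | h | h
    · refine Submodule.subset_span ⟨some ⟨i, ⟨m - k - 1, by omega⟩⟩, ?_⟩
      change cl K ((fwd K n i * bwd K n i) ^ (k + (m - k - 1) + 1)) = _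
      rw [show k + (m - k - 1) + 1 = m by omega]
    · rw [h, (relations K n).cl_pq_pow hn]
      exact Submodule.subset_span ⟨none, rfl⟩
    · rw [(relations K n).pq_pow_eq_zero hn i h, map_zero]
      exact zero_mem _

lemma finrank_cyc (hn : ∀ i, 1 ≤ n i) {k : ℕ} (hk : ∃ i, k < n i) :
    Module.finrank K (cyc K n k) = ∑ i, (n i - 1 - k) + 1 := by
  rw [← span_cycFamily hn hk, finrank_span_eq_card (linearIndependent_cycFamily hn k)]
  simp

end Detection

/-! ### Invariance of the filtration and recovery of the exponents. -/

section Comparison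

variable {K : Type u} [Field K] {n n' : Fin 3 → ℕ}

/-- The dimensions of the filtration are invariants of stable equivalences of Morita type. -/
theorem finrank_cyc_le (hn : ∀ i, 1 ≤ n i) (hn' : ∀ i, 1 ≤ n' i)
    (h : StablyEquivalentOfMoritaType K (Cyc K n) (Cyc K n')) (k : ℕ) :
    Module.finrank K (cyc K n k) ≤ Module.finrank K (cyc K n' k) := by
  have := finite (K := K) hn
  have := finite (K := K) hn'
  obtain ⟨s, t, hs, ht, hz⟩ := h.exists_transfer (mem_nilSpan hn) (mem_nilSpan hn')
  rw [nilSpan_eq hn, nilSpan_eq hn'] at hs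
  rw [nilSpan_eq hn, nilSpan_eq hn'] at ht
  obtain ⟨w, hw⟩ := hz (cycles K n)
  rw [nilSpan_eq hn'] at hw
  have hsw : ∀ h ∈ cyc K n 0, s (centerMul (cycles K n) h) = centerMul w (s h) := fun h hh => by
    rw [← hw _ (hs h hh).1, (hs h hh).2]
  have hiter : ∀ m, ∀ h ∈ cyc K n 0, (centerMul (cycles K n))^[m] h ∈ cyc K n m ∧
      s ((centerMul (cycles K n))^[m] h) = (centerMul w)^[m] (s h) := by
    intro m h hh
    induction m with
    | zero => exact ⟨hh, rfl⟩
    | succ m ih =>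
      rw [Function.iterate_succ_apply', Function.iterate_succ_apply', ← ih.2]
      exact ⟨centerMul_mem_cyc vtxChar_cycles ih.1, hsw _ (cyc_antitone (Nat.zero_le m) ih.1)⟩
  -- The class `σ` is nonzero and an eigenvector of `w` with eigenvalue the character at `i`. Since
  -- `w` is conjugate to the nilpotent action of `cycles`, a power of that eigenvalue vanishes.
  have hw0 : ∀ i, vtxChar i (w : Cyc K n') = 0 := by
    intro i
    set σ := cl K ((fwd K n' i * bwd K n' i) ^ n' i) with hσ
    have hσ0 : σ ∈ cyc K n' 0 := cl_mem_cycleSpan i (hn' i)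
    have h1 : ∀ m, (centerMul w)^[m] σ = vtxChar i (w : Cyc K n') ^ m • σ := by
      intro m
      induction m with
      | zero => simp
      | succ m ih =>
        rw [Function.iterate_succ_apply', ih, map_smul, centerMul_cl_pq_pow hn' w i, smul_smul,
          pow_succ]
    -- The number of iterations only has to bound every `n i`, so that the filtration step reached
    -- is zero.
    have h2 := hiter (n 0 + n 1 + n 2) (t σ) (ht σ hσ0).1
    rw [cyc_eq_bot hn (by intro i; fin_cases i <;> simp <;> omega), Submodule.mem_bot,
      (ht σ hσ0).2, h1] at h2
    have h3 := h2.2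
    rw [h2.1, map_zero] at h3
    have h4 := (smul_eq_zero.1 h3.symm).resolve_right (cl_pq_pow_ne_zero hn' i)
    exact eq_zero_of_pow_eq_zero h4
  have hmap : ∀ k, ∀ h ∈ cyc K n k, s h ∈ cyc K n' k := by
    intro k
    induction k with
    | zero => exact fun h hh => (hs h hh).1
    | succ k ih =>
      intro h hh
      refine (show cyc K n (k + 1) ≤ (cyc K n' (k + 1)).comap s from Submodule.span_le.2 ?_) hh
      rintro _ ⟨i, m, hm, rfl⟩
      obtain ⟨m, rfl⟩ : ∃ l, m = l + 1 := ⟨m - 1, by omega⟩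
      change s _ ∈ cyc K n' (k + 1)
      -- Each generator of step `k + 1` is `cycles` times a generator of step `k`; its image is `w`
      -- times an element of step `k`, and `w` raises the step.
      rw [← centerMul_cycles_cl i (by omega), hsw _ (cl_mem_cycleSpan i (by omega))]
      exact centerMul_mem_cyc hw0 (ih _ (cl_mem_cycleSpan i (by omega)))
  refine LinearMap.finrank_le_finrank_of_injective (f := s.restrict (hmap k)) ?_
  intro x y hxy
  have h0 : s x = s y := congrArg Subtype.val hxy
  ext
  rw [← (hs _ (cyc_antitone (Nat.zero_le k) x.2)).2, h0,
    (hs _ (cyc_antitone (Nat.zero_le k) y.2)).2]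

lemma finrank_cyc_eq {a b c : ℕ} (hab : b ≤ a) (hbc : c ≤ b) (hc : 1 ≤ c) (k : ℕ) :
    Module.finrank K (cyc K ![a, c, b] k) =
      if k < a then (a - 1 - k) + (c - 1 - k) + (b - 1 - k) + 1 else 0 := by
  have hn : ∀ i, 1 ≤ (![a, c, b] : Fin 3 → ℕ) i := by
    intro i
    fin_cases i <;> simp <;> omega
  split_ifs with h
  · rw [finrank_cyc hn ⟨0, h⟩, Fin.sum_univ_three]
    rfl
  · rw [cyc_eq_bot hn, finrank_bot]
    intro i
    fin_cases i <;> simp <;> omega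

end Comparison

end SD3K

end

theorem corollary5p4 (K : Type u) [Field K] [IsAlgClosed K] (a b c a' b' c' : ℕ)
    (ha : 2 ≤ a) (hab : b ≤ a) (hbc : c ≤ b) (hc : 1 ≤ c)
    (ha' : 2 ≤ a') (hab' : b' ≤ a') (hbc' : c' ≤ b') (hc' : 1 ≤ c') :
    StablyEquivalentOfMoritaType K (SD3K K a b c) (SD3K K a' b' c') ↔
      (a, b, c) = (a', b', c') := by
  constructor
  · intro h
    have hn : ∀ i, 1 ≤ (![a, c, b] : Fin 3 → ℕ) i := by
      intro i
      fin_cases i <;> simp <;> omega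
    have hn' : ∀ i, 1 ≤ (![a', c', b'] : Fin 3 → ℕ) i := by
      intro i
      fin_cases i <;> simp <;> omega
    have hle := SD3K.finrank_cyc_le (K := K) hn hn' h
    have hge := SD3K.finrank_cyc_le (K := K) hn' hn h.symm
    simp only [SD3K.finrank_cyc_eq hab hbc hc, SD3K.finrank_cyc_eq hab' hbc' hc'] at hle hge
    have key : ∀ k, (if k < a then (a - 1 - k) + (c - 1 - k) + (b - 1 - k) + 1 else 0) =
        if k < a' then (a' - 1 - k) + (c' - 1 - k) + (b' - 1 - k) + 1 else 0 :=
      fun k => le_antisymm (hle k) (hge k)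
    -- The largest exponent is the first `k` at which the dimension drops to zero.
    have h1 : a = a' := by
      have h1 := key a
      have h2 := key a'
      split_ifs at h1 h2 <;> omega
    -- At `k` one less than the smaller of `b` and `b'`, the side with the smaller value has
    -- dimension `a - 1 - k + 1`, and the other side would have more. The same comparison then
    -- settles `c`.
    have h2 : b = b' := by
      have h2 := key (b - 1)
      have h3 := key (b' - 1)
      split_ifs at h2 h3 <;> omega
    have h3 : c = c' := by
      have h3 := key (c - 1)
      have h4 := key (c' - 1)
      split_ifs at h3 h4 <;> omega
    rw [h1, h2, h3]
  · intro h
    obtain ⟨rfl, rfl, rfl⟩ : a = a' ∧ b = b' ∧ c = c' := by simpa using h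
    exact StablyEquivalentOfMoritaType.refl K _
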